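/- Let $H$ be an $N\times N$ Hermitian matrix, $\mathrm{abs}(H)=(|H_{jk}|)_{j,k}$, and $\|\cdot\|$ the spectral norm. Suppose first that the graph of nonzero entries of $H$ is connected and that all $H_{jj}\ge 0$. Put $r=\|\mathrm{abs}(H)\|$, let $d$ be a positive eigenvector of $\mathrm{abs}(H)$ with eigenvalue $r$ (it exists), and let $$|\psi_j\rangle=\frac1{\sqrt r}\sum_{k}\sqrt{H_{jk}^*\,\frac{d_k}{d_j}}\;|j,k\rangle,\qquad T=\sum_j|\psi_j\rangle\langle j|,\qquad S|j,k\rangle=|k,j\rangle,\qquad U=iS(2TT^\dagger-1),$$ where the square roots are chosen such that $\sqrt{z^*}=(\sqrt z)^*$ for corresponding entries $z=H_{jk}$, $z^*=H_{kj}$ (such choices exist; if $N=1$ and $H=0$, read $|\psi_1\rangle=|1,1\rangle$). Then $U$ is unitary. For $M\ge1$ let $P$ be coherent phase estimation on $U$: append an $M$-dimensional register in the state $\sqrt{\tfrac{2}{M+1}}\sum_{x=0}^{M-1}\sin\tfrac{\pi(x+1)}{M+1}|x\rangle$, apply $\sum_x U^x\otimes|x\rangle\langle x|$, and apply the inverse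 Fourier transform modulo $M$ to the register, which then holds an estimate $\phi=2\pi j/M$, $0\le j<M$, of the eigenphase. Let $F$ be the multiplication by $e^{-irt\sin\phi}$ and let $V=T^\dagger P^\dagger F P T$ be the simulation of $e^{-iHt}$; its fidelity on a unit vector $\psi$ is $|\langle\psi|e^{iHt}V|\psi\rangle|$. (1) For every unitary $U$ on a finite-dimensional space, every unit eigenvector of $U$ with eigenvalue $e^{i\theta}$ and every $M\ge1$, the phase estimation above has mean-square error (in the distance on the circle $\mathbb R/2\pi\mathbb Z$) at most $186/M^2$. (2) For all $M\ge 1$ and $t\ge0$, $V$ is implemented with exactly $2(M-1)$ register-controlled steps of $U$ or $U^{-1}$, all other gates between $T$ and $T^\dagger$ acting on the register alone, and its fidelity is at least $1-93(\|\mathrm{abs}(H)\|t)^2/M^2$ on every unit vector. (3) There is an absolute constant $C$ such that for all such $H$ and all $t\ge0$, $\delta>0$ there is an $M\ge1$ for which $V$ uses $2(M-1)\le C\,\|\mathrm{abs}(H)\|\,t/\sqrt\delta$ steps of $U$ and has fidelity at least $1-\delta$ on every unit vector. (4) The same holds, with an absolute constant $C$, for every Hermitian matrix $H$, if one takes the walk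 of $K=H+c$, $c=\max_j\max(0,-H_{jj})$, that treats the connected components of the graph of nonzero entries side by side: $r$ is replaced by the number $r_j=\|\mathrm{abs}(K_{c(j)})\|$, where $K_{c(j)}$ is the block of $K$ on the component of $j$; $d$ is a positive vector with $\mathrm{abs}(K)d=(r_jd_j)_j$ (it exists); $|\psi_j\rangle=|j,j\rangle$ if $r_j=0$; $F$ multiplies $|j,k\rangle|\phi\rangle$ by $e^{-ir_jt\sin\phi}$; and register gates may depend on the component of $j$. The bound on the number of steps is $C\,\|\mathrm{abs}(H)\|\,t/\sqrt\delta$, with the original $H$, and the fidelity is $|\langle\psi|e^{iHt}V|\psi\rangle|\ge1-\delta$. -/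

import Mathlib

open scoped Kronecker

namespace QWalk

noncomputable section

/-! ### Hamiltonians -/

/-- The elementwise absolute value `abs(H)`. -/
def absMatrix {ι : Type} (H : Matrix ι ι ℂ) : Matrix ι ι ℝ :=
  Matrix.of fun j k => ‖H j k‖

/-- The operator norm induced by the Euclidean norm. -/
def opNorm {ι : Type} [Fintype ι] [DecidableEq ι] (A : Matrix ι ι ℝ) : ℝ :=
  ‖Matrix.toEuclideanCLM (𝕜 := ℝ) A‖

/-- The graph of nonzero entries of `H`.  (Loops are irrelevant here: only the connected
components are used.) -/
def hamGraph {ι : Type} (H : Matrix ι ι ℂ) : SimpleGraph ι :=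
  SimpleGraph.fromRel fun j k => H j k ≠ 0

open Classical in
/-- `‖abs(H_c)‖`, where `H_c` is the block of `H` on the connected component `c` of `j` in the
graph of nonzero entries (the block is padded with zeros, which does not change its norm). -/
def componentNorm {ι : Type} [Fintype ι] (H : Matrix ι ι ℂ) (j : ι) : ℝ :=
  opNorm (Matrix.of fun a b : ι =>
    if (hamGraph H).Reachable j a ∧ (hamGraph H).Reachable j b then absMatrix H a b else 0)

/-- `max_j max(0, -H_jj)`: the least nonnegative multiple of the identity that has to be added
to `H` in order to make all diagonal entries nonnegative. -/
def energyShift {ι : Type} (H : Matrix ι ι ℂ) : ℝ :=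
  ⨆ j, max 0 (-(H j j).re)

/-- `H` with its zero of energy moved so that all diagonal entries are nonnegative. -/
def shifted {ι : Type} [DecidableEq ι] (H : Matrix ι ι ℂ) : Matrix ι ι ℂ :=
  H + (energyShift H : ℂ) • (1 : Matrix ι ι ℂ)

/-! ### The discrete-time quantum walk -/

/-- `d` is an entrywise positive eigenvector of `abs(H)`, with eigenvalue `r j` on the component
of `j`. For constant `r = ‖abs(H)‖` this is a positive principal eigenvector of `abs(H)`. -/
def IsPrincipal {ι : Type} [Fintype ι] (H : Matrix ι ι ℂ) (r d : ι → ℝ) : Prop :=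
  (∀ j, 0 < d j) ∧ ∀ j, (absMatrix H).mulVec d j = r j * d j

/-- `s j k` is a square root of `H_jk^*`, the branches being chosen consistently, that is, such
that the square roots of complex conjugate numbers are complex conjugate. -/
def IsRootChoice {ι : Type} (H : Matrix ι ι ℂ) (s : ι → ι → ℂ) : Prop :=
  ∀ j k, s j k ^ 2 = star (H j k) ∧ s k j = star (s j k)

/-- The state `|ψ_j⟩ = r_j^{-1/2} ∑_k √(H_jk^* d_k / d_j) |j,k⟩`, with `s j k` for `√(H_jk^*)`.
If `r j = 0` (that is, `j` is isolated and `H_jj = 0`), the expression is `0/0` and is read as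
`|j,j⟩`, its value for any `H_jj > 0`. -/
def walkState {ι : Type} [DecidableEq ι] (r d : ι → ℝ) (s : ι → ι → ℂ) (j : ι) :
    ι × ι → ℂ := fun p =>
  if r j = 0 then (if p = (j, j) then 1 else 0)
  else if p.1 = j then
    ((Real.sqrt (r j) : ℝ) : ℂ)⁻¹ * (s j p.2 * ((Real.sqrt (d p.2 / d j) : ℝ) : ℂ))
  else 0

/-- The isometry `T = ∑_j |ψ_j⟩⟨j|`. -/
def walkIsometry {ι : Type} [DecidableEq ι] (r d : ι → ℝ) (s : ι → ι → ℂ) :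
    Matrix (ι × ι) ι ℂ :=
  Matrix.of fun p j => walkState r d s j p

/-- The swap `S|j,k⟩ = |k,j⟩`. -/
def swapMatrix (ι : Type) [DecidableEq ι] : Matrix (ι × ι) (ι × ι) ℂ :=
  Matrix.of fun p q => if p = q.swap then 1 else 0

/-- The walk `U = i S (2 T T† - 1)`. -/
def walk {ι : Type} [Fintype ι] [DecidableEq ι] (T : Matrix (ι × ι) ι ℂ) :
    Matrix (ι × ι) (ι × ι) ℂ :=
  Complex.I • (swapMatrix ι * ((2 : ℂ) • (T * T.conjTranspose) - 1))

/-! ### Circuits and their number of walk steps -/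

/-- The register operation `R (l k)` applied conditionally on the label `l k` of the basis
state `|k⟩` of the system (an operation on the register alone if `l` is constant). -/
def registerGate {κ ρ L : Type} [DecidableEq κ] (l : κ → L) (R : L → Matrix ρ ρ ℂ) :
    Matrix (κ × ρ) (κ × ρ) ℂ :=
  Matrix.of fun p q => if p.1 = q.1 then R (l p.1) p.2 q.2 else 0

/-- One step of `U`, controlled by the register: `U` is applied if the register is in a basis
state `|x⟩` with `b x = true`. -/
def controlledStep {κ ρ : Type} [DecidableEq κ] [DecidableEq ρ] (U : Matrix κ κ ℂ)
    (b : ρ → Bool) : Matrix (κ × ρ) (κ × ρ) ℂ :=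
  Matrix.of fun p q =>
    if p.2 = q.2 then (if b p.2 then U p.1 q.1 else (1 : Matrix κ κ ℂ) p.1 q.1) else 0

/-- `WalkCircuit l U n A`: the operator `A` on system and register is implemented by a circuit
that contains exactly `n` controlled steps of `U` or of its inverse, all other gates being
unitary operations on the register alone (conditional on the label of the system). -/
inductive WalkCircuit {κ ρ L : Type} [Fintype κ] [DecidableEq κ] [Fintype ρ] [DecidableEq ρ]
    (l : κ → L) (U : Matrix κ κ ℂ) : ℕ → Matrix (κ × ρ) (κ × ρ) ℂ → Prop
  | register (R : L → Matrix ρ ρ ℂ) (hR : ∀ c, R c ∈ Matrix.unitaryGroup ρ ℂ) :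
      WalkCircuit l U 0 (registerGate l R)
  | step (b : ρ → Bool) : WalkCircuit l U 1 (controlledStep U b)
  | stepInv (b : ρ → Bool) : WalkCircuit l U 1 (controlledStep U b).conjTranspose
  | comp {m n : ℕ} {A B : Matrix (κ × ρ) (κ × ρ) ℂ} :
      WalkCircuit l U m A → WalkCircuit l U n B → WalkCircuit l U (m + n) (A * B)

/-- The operation of appending the register in the state `χ`. -/
def appendRegister (κ : Type) {ρ : Type} [DecidableEq κ] (χ : ρ → ℂ) : Matrix (κ × ρ) κ ℂ :=
  Matrix.of fun p k => if p.1 = k then χ p.2 else 0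

/-- `V` is implemented with `n` steps of the walk `U`: apply `T`, append a register in a
normalized state, run a circuit with `n` steps, and undo the first two operations. -/
def UsesWalkSteps {ι κ L : Type} [Fintype κ] [DecidableEq κ] (l : κ → L)
    (U : Matrix κ κ ℂ) (T : Matrix κ ι ℂ) (n : ℕ) (V : Matrix ι ι ℂ) : Prop :=
  ∃ (m : ℕ) (χ : Fin m → ℂ) (A : Matrix (κ × Fin m) (κ × Fin m) ℂ),
    ∑ x, ‖χ x‖ ^ 2 = 1 ∧ WalkCircuit l U n A ∧
      V = T.conjTranspose * (appendRegister κ χ).conjTranspose * A * appendRegister κ χ * T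

/-! ### Phase estimation and the simulation -/

/-- The initial state `√(2/(M+1)) ∑_{x<M} sin(π(x+1)/(M+1)) |x⟩` of the register. -/
def sineWindow (M : ℕ) : Fin M → ℂ := fun x =>
  ((Real.sqrt (2 / ((M : ℝ) + 1)) *
    Real.sin (Real.pi * ((x : ℕ) + 1) / ((M : ℝ) + 1)) : ℝ) : ℂ)

/-- The phase estimate `φ_j = 2πj/M`. -/
def estimate (M : ℕ) (j : Fin M) : ℝ := 2 * Real.pi * (j : ℕ) / M

/-- The inverse Fourier transform `M^{-1/2} ∑_{j,x} e^{-2πijx/M} |j⟩⟨x|`. -/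
def invFourier (M : ℕ) : Matrix (Fin M) (Fin M) ℂ :=
  Matrix.of fun j x =>
    ((Real.sqrt M : ℝ) : ℂ)⁻¹ * Complex.exp (-(Complex.I * ((estimate M j * (x : ℕ) : ℝ) : ℂ)))

/-- The operation `∑_x U^x ⊗ |x⟩⟨x|`. -/
def selectPower {κ : Type} [Fintype κ] [DecidableEq κ] (M : ℕ) (U : Matrix κ κ ℂ) :
    Matrix (κ × Fin M) (κ × Fin M) ℂ :=
  Matrix.of fun p q => if p.2 = q.2 then (U ^ (p.2 : ℕ)) p.1 q.1 else 0

/-- Coherent phase estimation `P` on `U`, modulo `M`, with the sine window: append the register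
in the state `sineWindow M`, apply `∑_x U^x ⊗ |x⟩⟨x|`, and apply the inverse Fourier transform to
the register. The register then holds the estimate `|j⟩` of the phase `φ_j`. -/
def phaseEstimation {κ : Type} [Fintype κ] [DecidableEq κ] (M : ℕ) (U : Matrix κ κ ℂ) :
    Matrix (κ × Fin M) κ ℂ :=
  ((1 : Matrix κ κ ℂ) ⊗ₖ invFourier M) * selectPower M U * appendRegister κ (sineWindow M)

/-- The probability that phase estimation on `U`, applied to the state `v`, yields `φ_j`. -/
def outcomeProb {κ : Type} [Fintype κ] [DecidableEq κ] (M : ℕ) (U : Matrix κ κ ℂ)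
    (v : κ → ℂ) (j : Fin M) : ℝ :=
  ∑ k, ‖(phaseEstimation M U).mulVec v (k, j)‖ ^ 2

/-- The distance of the estimate `φ_j` from `θ` on the circle, with sign, in `(-π, π]`. -/
def phaseError (M : ℕ) (θ : ℝ) (j : Fin M) : ℝ :=
  ((θ - estimate M j : ℝ) : Real.Angle).toReal

/-- The operation `F`, which multiplies `|k⟩|j⟩` by the phase `e^{-i τ_k sin φ_j}`. -/
def phaseGate {κ : Type} [DecidableEq κ] (M : ℕ) (τ : κ → ℝ) :
    Matrix (κ × Fin M) (κ × Fin M) ℂ :=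
  Matrix.diagonal fun p =>
    Complex.exp (-(Complex.I * ((τ p.1 * Real.sin (estimate M p.2) : ℝ) : ℂ)))

/-- The simulation `T† P† F P T` of the Hamiltonian evolution for time `t`. The eigenphases `θ` of
the walk encode the eigenvalues `sin θ` of `H` in units of `r`, so the phase applied by `F` is
`e^{-i r t sin φ}` (with the `r` of the component on which the walk takes place). -/
def simulation {ι : Type} [Fintype ι] [DecidableEq ι] (M : ℕ) (r : ι → ℝ) (t : ℝ)
    (T : Matrix (ι × ι) ι ℂ) : Matrix ι ι ℂ :=
  let P : Matrix ((ι × ι) × Fin M) (ι × ι) ℂ := phaseEstimation M (walk T)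
  let F : Matrix ((ι × ι) × Fin M) ((ι × ι) × Fin M) ℂ := phaseGate M fun p => r p.1 * t
  T.conjTranspose * P.conjTranspose * F * P * T

/-- The evolution operator `e^{-iHt}`. -/
def evolution {ι : Type} [Fintype ι] [DecidableEq ι] (H : Matrix ι ι ℂ) (t : ℝ) :
    Matrix ι ι ℂ :=
  NormedSpace.exp ((-(Complex.I * (t : ℂ))) • H)

/-- The fidelity `|⟨ψ| e^{iHt} V |ψ⟩|` of the simulated state `V|ψ⟩` with `e^{-iHt}|ψ⟩`. -/
def fidelity {ι : Type} [Fintype ι] [DecidableEq ι] (H : Matrix ι ι ℂ) (t : ℝ)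
    (V : Matrix ι ι ℂ) (ψ : ι → ℂ) : ℝ :=
  ‖star ((evolution H t).mulVec ψ) ⬝ᵥ V.mulVec ψ‖

end

end QWalk

open QWalk

open scoped Kronecker

namespace QWalk

noncomputable section

/-! ### Isometries -/

/-! The isometry $T$ satisfies $T^\dagger T=1$ and $r_j(T^\dagger ST)_{jk}=K_{jk}$. Although the
range of $T$ is not invariant under the walk $U$, it is invariant under $(U-U^\dagger)/2i$, which
acts there as $T^\dagger ST$ (`phaseSine_walk_mul`). Hence $T$ intertwines $e^{-iKt}$ with
$\exp(-irt\sin\theta)$, where $\theta$ is the eigenphase of $U$ (`walkIsometry_mul_evolution`). The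
simulation applies the same function to the estimate $\phi$ in place of $\theta$.

Expand $T\psi$ in orthogonal eigenvectors of $U$. The overlap with the exact evolution is then an
average of expectations of $e^{i\rho(\sin\theta-\sin\phi)}$ with $\rho=rt$. The term of first order
is imaginary, so the real part is at least $1-\tfrac{\rho^2}{2}\,E(\sin\theta-\sin\phi)^2$
(`re_sum_phase_ge`): only the mean-square error of phase estimation matters, and the loss is of
order $(rt/M)^2$. This is why $1/\sqrt\delta$ steps suffice.

The mean-square error is measured by the chord $|e^{i\theta}-e^{i\phi}|$. Multiplying the amplitude
of $\phi_j$ by $1-e^{i(\theta-\phi_j)}$ replaces the window by its cyclic difference, so by Parseval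
the error is the squared norm of that difference. It is $O(1/M^2)$ because the sine window varies
slowly and is small at both ends (`sum_chord_sq_mul_phaseAmplitude_le`).

The vector $d$ comes from a Perron–Frobenius argument on each component. In the general case the
shift $c$ at most doubles the norm and changes the evolution by a global phase. The rates of the
different components form a diagonal operator that commutes with $U$, so joint eigenvectors can be
used. -/

theorem star_dotProduct_self {κ : Type} [Fintype κ] (v : κ → ℂ) :
    star v ⬝ᵥ v = ((∑ k, ‖v k‖ ^ 2 : ℝ) : ℂ) := by
  simp [dotProduct, Complex.conj_mul']

theorem star_mulVec_dotProduct_mulVec {κ μ ν : Type} [Fintype κ] [Fintype μ] [Fintype ν]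
    (A : Matrix κ μ ℂ) (B : Matrix κ ν ℂ) (v : μ → ℂ) (w : ν → ℂ) :
    star (A.mulVec v) ⬝ᵥ B.mulVec w = star v ⬝ᵥ (A.conjTranspose * B).mulVec w := by
  rw [Matrix.star_mulVec, ← Matrix.dotProduct_mulVec, Matrix.mulVec_mulVec]

theorem sum_norm_sq_mulVec_of_isometry {κ μ : Type} [Fintype κ] [Fintype μ] [DecidableEq μ]
    {A : Matrix κ μ ℂ} (hA : A.conjTranspose * A = 1) (v : μ → ℂ) :
    ∑ k, ‖A.mulVec v k‖ ^ 2 = ∑ k, ‖v k‖ ^ 2 := by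
  have h := star_mulVec_dotProduct_mulVec A A v v
  rw [hA, Matrix.one_mulVec, star_dotProduct_self, star_dotProduct_self] at h
  exact_mod_cast h

/-! ### The Fourier transform and the sine window -/

theorem invFourier_conjTranspose_mul_self (M : ℕ) :
    (invFourier M).conjTranspose * invFourier M = 1 := by
  ext x y
  have hM : (M : ℝ) ≠ 0 := by
    have := x.pos
    positivity
  have hMc : (M : ℂ) ≠ 0 := by exact_mod_cast hM
  have hω := Complex.isPrimitiveRoot_exp M (by exact_mod_cast hM)
  set ω := Complex.exp (2 * Real.pi * Complex.I / M) with hωdef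
  have hω0 : ω ≠ 0 := Complex.exp_ne_zero _
  have key : ∀ j : Fin M, (invFourier M).conjTranspose x j * invFourier M j y =
      (M : ℂ)⁻¹ * (ω ^ (x : ℕ) * (ω ^ (y : ℕ))⁻¹) ^ (j : ℕ) := by
    intro j
    have h1 : Complex.exp (Complex.I * ((estimate M j * (x : ℕ) : ℝ) : ℂ)) =
        (ω ^ (x : ℕ)) ^ (j : ℕ) := by
      rw [← pow_mul, hωdef, ← Complex.exp_nat_mul]
      congr 1
      simp only [estimate]
      push_cast
      field_simp
    have h2 : Complex.exp (-(Complex.I * ((estimate M j * (y : ℕ) : ℝ) : ℂ))) =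
        ((ω ^ (y : ℕ))⁻¹) ^ (j : ℕ) := by
      rw [Complex.exp_neg, inv_pow, ← pow_mul, hωdef, ← Complex.exp_nat_mul]
      congr 2
      simp only [estimate]
      push_cast
      field_simp
    have h3 : ((Real.sqrt M : ℝ) : ℂ)⁻¹ * ((Real.sqrt M : ℝ) : ℂ)⁻¹ = (M : ℂ)⁻¹ := by
      rw [← mul_inv, ← Complex.ofReal_mul, Real.mul_self_sqrt (Nat.cast_nonneg M)]
      simp
    simp only [invFourier, Matrix.conjTranspose_apply, Matrix.of_apply, star_mul', star_inv₀,
      RCLike.star_def, Complex.conj_ofReal, ← Complex.exp_conj, map_neg, map_mul, Complex.conj_I]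
    rw [neg_mul, neg_neg]
    rw [h1, h2, mul_pow, ← h3]
    ring
  rw [Matrix.mul_apply, Finset.sum_congr rfl fun j _ => key j, ← Finset.mul_sum,
    Fin.sum_univ_eq_sum_range (fun j => (ω ^ (x : ℕ) * (ω ^ (y : ℕ))⁻¹) ^ j)]
  by_cases hxy : x = y
  · subst hxy
    simp [hω0, hMc]
  · have hz : ω ^ (x : ℕ) * (ω ^ (y : ℕ))⁻¹ ≠ 1 := by
      intro h
      apply hxy
      rw [mul_inv_eq_one₀ (pow_ne_zero _ hω0)] at h
      exact Fin.ext (hω.pow_inj x.2 y.2 h)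
    rw [geom_sum_eq hz, mul_pow, inv_pow, ← pow_mul, ← pow_mul, mul_comm (x : ℕ), mul_comm (y : ℕ),
      pow_mul, pow_mul, hω.pow_eq_one]
    simp [hxy]

theorem invFourier_mem_unitaryGroup (M : ℕ) :
    invFourier M ∈ Matrix.unitaryGroup (Fin M) ℂ :=
  Matrix.mem_unitaryGroup_iff'.2 (invFourier_conjTranspose_mul_self M)

/-- By the half-angle formula the sum reduces to the real part of the sum of all $(M+1)$-th roots of
unity, which vanishes as $M+1>1$. The extra term $x=0$ is $\sin^2 0$. -/
theorem sum_sin_sq (M : ℕ) (hM : 1 ≤ M) :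
    ∑ x ∈ Finset.range M, Real.sin (Real.pi * (x + 1) / (M + 1)) ^ 2 = ((M : ℝ) + 1) / 2 := by
  have hprim := Complex.isPrimitiveRoot_exp (M + 1) (by omega)
  have h0 := hprim.geom_sum_eq_zero (by omega)
  have hcos : ∑ x ∈ Finset.range (M + 1), Real.cos (2 * (Real.pi * x / (M + 1))) = 0 := by
    have := congrArg Complex.re h0
    rw [Complex.re_sum] at this
    rw [← Complex.zero_re, ← this]
    refine Finset.sum_congr rfl fun x _ => ?_
    rw [← Complex.exp_nat_mul, ← Complex.exp_ofReal_mul_I_re]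
    congr 2
    push_cast
    ring
  have hs : ∑ x ∈ Finset.range (M + 1), Real.sin (Real.pi * x / (M + 1)) ^ 2 =
      ((M : ℝ) + 1) / 2 := by
    have : ∀ x ∈ Finset.range (M + 1), Real.sin (Real.pi * x / (M + 1)) ^ 2 =
        1 / 2 - Real.cos (2 * (Real.pi * x / (M + 1))) / 2 := by
      intro x _
      rw [Real.sin_sq_eq_half_sub]
    rw [Finset.sum_congr rfl this, Finset.sum_sub_distrib, ← Finset.sum_div, ← Finset.sum_div,
      hcos]
    simp
  rw [Finset.sum_range_succ'] at hs
  simpa using hs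

/-- The amplitudes of the sine window, at all natural numbers. -/
def windowAmplitude (M x : ℕ) : ℝ :=
  Real.sqrt (2 / ((M : ℝ) + 1)) * Real.sin (Real.pi * ((x : ℕ) + 1) / ((M : ℝ) + 1))

theorem sineWindow_apply (M : ℕ) (x : Fin M) : sineWindow M x = (windowAmplitude M x : ℂ) := rfl

theorem sum_norm_sq_sineWindow (M : ℕ) (hM : 1 ≤ M) : ∑ x, ‖sineWindow M x‖ ^ 2 = 1 := by
  simp only [sineWindow_apply, Complex.norm_real, Real.norm_eq_abs, sq_abs, windowAmplitude,
    mul_pow]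
  rw [← Finset.mul_sum,
    Fin.sum_univ_eq_sum_range (fun x => Real.sin (Real.pi * ((x : ℕ) + 1) / ((M : ℝ) + 1)) ^ 2),
    sum_sin_sq M hM, Real.sq_sqrt (by positivity)]
  field_simp

theorem abs_windowAmplitude_succ_sub_le (M x : ℕ) :
    |windowAmplitude M (x + 1) - windowAmplitude M x| ≤
      Real.sqrt (2 / ((M : ℝ) + 1)) * (Real.pi / (M + 1)) := by
  rw [windowAmplitude, windowAmplitude, ← mul_sub, abs_mul, abs_of_nonneg (Real.sqrt_nonneg _)]
  gcongr
  refine (Real.abs_sin_sub_sin_le _ _).trans (le_of_eq ?_)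
  rw [← abs_of_nonneg (show (0 : ℝ) ≤ Real.pi / (M + 1) by positivity)]
  congr 1
  push_cast
  ring

theorem abs_windowAmplitude_zero_le (M : ℕ) :
    |windowAmplitude M 0| ≤ Real.sqrt (2 / ((M : ℝ) + 1)) * (Real.pi / (M + 1)) := by
  rw [windowAmplitude, abs_mul, abs_of_nonneg (Real.sqrt_nonneg _)]
  gcongr
  refine Real.abs_sin_le_abs.trans (le_of_eq ?_)
  rw [abs_of_nonneg (by positivity)]
  simp

theorem windowAmplitude_last (m : ℕ) : windowAmplitude (m + 1) m = windowAmplitude (m + 1) 0 := by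
  rw [windowAmplitude, windowAmplitude, ← Real.sin_pi_sub]
  congr 2
  push_cast
  field_simp
  ring

/-! ### The error of phase estimation -/

/-- The amplitude with which phase estimation on an eigenvector with eigenphase `θ` yields the
`j`-th estimate. -/
def phaseAmplitude (M : ℕ) (θ : ℝ) (j : Fin M) : ℂ :=
  (invFourier M).mulVec
    (fun x => sineWindow M x * Complex.exp (Complex.I * (θ : ℂ)) ^ (x : ℕ)) j

theorem norm_exp_I_mul_ofReal (θ : ℝ) : ‖Complex.exp (Complex.I * (θ : ℂ))‖ = 1 := by
  rw [mul_comm, Complex.norm_exp_ofReal_mul_I]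

theorem sum_norm_sq_phaseAmplitude (M : ℕ) (hM : 1 ≤ M) (θ : ℝ) :
    ∑ j, ‖phaseAmplitude M θ j‖ ^ 2 = 1 := by
  unfold phaseAmplitude
  rw [sum_norm_sq_mulVec_of_isometry (invFourier_conjTranspose_mul_self M),
    ← sum_norm_sq_sineWindow M hM]
  simp

/-- Summation by parts on the cyclic group: multiplication by $e^{-i\phi_j}$ after the Fourier
transform is a cyclic shift of the register before it. Entry $0$ holds the wrap-around term, which
keeps the factor $e^{i\theta M}$ because $\theta$ need not be a multiple of $2\pi/M$. -/
theorem one_sub_exp_mul_phaseAmplitude (m : ℕ) (θ : ℝ) (j : Fin (m + 1)) :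
    (1 - Complex.exp (Complex.I * ((θ - estimate (m + 1) j : ℝ) : ℂ))) *
        phaseAmplitude (m + 1) θ j =
      (invFourier (m + 1)).mulVec
        (Fin.cons ((windowAmplitude (m + 1) 0 : ℂ) -
            windowAmplitude (m + 1) m * Complex.exp (Complex.I * (θ : ℂ)) ^ (m + 1))
          (fun x : Fin m => ((windowAmplitude (m + 1) (x + 1) : ℂ) - windowAmplitude (m + 1) x) *
            Complex.exp (Complex.I * (θ : ℂ)) ^ ((x : ℕ) + 1)) : Fin (m + 1) → ℂ) j := by
  set e := Complex.exp (Complex.I * (θ : ℂ)) with he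
  set f := Complex.exp (-(Complex.I * (estimate (m + 1) j : ℂ))) with hf
  set c := ((Real.sqrt ((m + 1 : ℕ) : ℝ) : ℝ) : ℂ)⁻¹ with hc
  set a : ℕ → ℂ := fun x => (windowAmplitude (m + 1) x : ℂ) with ha
  have hz : Complex.exp (Complex.I * ((θ - estimate (m + 1) j : ℝ) : ℂ)) = e * f := by
    rw [he, hf, ← Complex.exp_add]
    congr 1
    push_cast
    ring
  have hfM : f ^ (m + 1) = 1 := by
    rw [hf, ← Complex.exp_nat_mul, Complex.exp_eq_one_iff]
    refine ⟨-(j : ℕ), ?_⟩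
    simp only [estimate]
    push_cast
    have : (m : ℂ) + 1 ≠ 0 := by exact_mod_cast Nat.succ_ne_zero m
    field_simp
  have hQ : ∀ x : Fin (m + 1), invFourier (m + 1) j x = c * f ^ (x : ℕ) := by
    intro x
    rw [invFourier, Matrix.of_apply, hf, ← Complex.exp_nat_mul]
    congr 2
    push_cast
    ring
  rw [hz]
  simp only [phaseAmplitude, Matrix.mulVec, dotProduct, hQ, sineWindow_apply]
  rw [Fin.sum_univ_succ (n := m) (f := fun x => c * f ^ (x : ℕ) *
    (Fin.cons (a 0 - a m * e ^ (m + 1)) (fun x : Fin m => (a (x + 1) - a x) * e ^ ((x : ℕ) + 1)) :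
      Fin (m + 1) → ℂ) x)]
  simp only [Fin.cons_zero, Fin.cons_succ, Fin.val_zero, Fin.val_succ, pow_zero, mul_one]
  rw [Fin.sum_univ_eq_sum_range (fun x => c * f ^ x * (a x * e ^ x)) (m + 1),
    Fin.sum_univ_eq_sum_range (fun x => c * f ^ (x + 1) * ((a (x + 1) - a x) * e ^ (x + 1))) m,
    sub_mul, one_mul]
  nth_rewrite 1 [Finset.sum_range_succ']
  rw [Finset.sum_range_succ, mul_add, Finset.mul_sum]
  have h3 : ∀ x ∈ Finset.range m, c * f ^ (x + 1) * ((a (x + 1) - a x) * e ^ (x + 1)) =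
      c * f ^ (x + 1) * (a (x + 1) * e ^ (x + 1)) - e * f * (c * f ^ x * (a x * e ^ x)) := by
    intro x _
    ring
  rw [Finset.sum_congr rfl h3, Finset.sum_sub_distrib]
  have h4 : e * f * (c * f ^ m * (a m * e ^ m)) = c * (a m * e ^ (m + 1)) := by
    calc _ = c * (a m * e ^ (m + 1)) * f ^ (m + 1) := by ring
      _ = _ := by rw [hfM, mul_one]
  rw [h4]
  simp
  ring

theorem norm_one_sub_exp_sq (x : ℝ) :
    ‖1 - Complex.exp (Complex.I * (x : ℂ))‖ ^ 2 = 2 * (1 - Real.cos x) := by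
  rw [mul_comm, ← Complex.normSq_eq_norm_sq, Complex.normSq_apply]
  simp only [Complex.sub_re, Complex.one_re, Complex.exp_ofReal_mul_I_re, Complex.sub_im,
    Complex.one_im, Complex.exp_ofReal_mul_I_im]
  nlinarith [Real.sin_sq_add_cos_sq x]

/-- The mean-square error of phase estimation in the chordal distance. -/
theorem sum_chord_sq_mul_phaseAmplitude_le (M : ℕ) (hM : 1 ≤ M) (θ : ℝ) :
    ∑ j, 2 * (1 - Real.cos (θ - estimate M j)) * ‖phaseAmplitude M θ j‖ ^ 2 ≤
      4 * Real.pi ^ 2 / ((M : ℝ) + 1) ^ 2 := by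
  obtain ⟨m, rfl⟩ : ∃ m, M = m + 1 := ⟨M - 1, by omega⟩
  simp only [← norm_one_sub_exp_sq, ← mul_pow, ← norm_mul, one_sub_exp_mul_phaseAmplitude]
  rw [sum_norm_sq_mulVec_of_isometry (invFourier_conjTranspose_mul_self _), Fin.sum_univ_succ]
  simp only [Fin.cons_zero, Fin.cons_succ]
  -- `L` bounds every increment of the window and also both end values, so the wrap-around entry is
  -- at most $2L$. The total is $(M+3)L^2\le 2(M+1)L^2$ since $M\ge1$.
  set L := Real.sqrt (2 / (((m + 1 : ℕ) : ℝ) + 1)) * (Real.pi / ((m + 1 : ℕ) + 1)) with hL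
  have hL0 : 0 ≤ L := by positivity
  have h0 : ‖(windowAmplitude (m + 1) 0 : ℂ) -
      windowAmplitude (m + 1) m * Complex.exp (Complex.I * (θ : ℂ)) ^ (m + 1)‖ ≤ 2 * L := by
    refine (norm_sub_le _ _).trans ?_
    rw [norm_mul, norm_pow, norm_exp_I_mul_ofReal, one_pow, mul_one, windowAmplitude_last,
      Complex.norm_real, Real.norm_eq_abs]
    have := abs_windowAmplitude_zero_le (m + 1)
    linarith
  have h1 : ∀ x : Fin m, ‖((windowAmplitude (m + 1) (x + 1) : ℂ) - windowAmplitude (m + 1) x) *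
      Complex.exp (Complex.I * (θ : ℂ)) ^ ((x : ℕ) + 1)‖ ^ 2 ≤ L ^ 2 := by
    intro x
    rw [norm_mul, norm_pow, norm_exp_I_mul_ofReal, one_pow, mul_one, ← Complex.ofReal_sub,
      Complex.norm_real, Real.norm_eq_abs]
    gcongr
    exact abs_windowAmplitude_succ_sub_le (m + 1) x
  have hL2 : L ^ 2 = 2 * Real.pi ^ 2 / (((m + 1 : ℕ) : ℝ) + 1) ^ 3 := by
    rw [hL, mul_pow, Real.sq_sqrt (by positivity)]
    field_simp
  calc _ ≤ (2 * L) ^ 2 + ∑ _x : Fin m, L ^ 2 := by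
        exact add_le_add (by gcongr) (Finset.sum_le_sum fun x _ => h1 x)
    _ = (4 + m) * L ^ 2 := by
        simp
        ring
    _ ≤ (2 * (((m + 1 : ℕ) : ℝ) + 1)) * L ^ 2 := by
        gcongr
        push_cast
        linarith [(Nat.cast_nonneg m : (0 : ℝ) ≤ m)]
    _ = _ := by
        rw [hL2]
        field_simp
        ring

/-- An arc of length at most $\pi$ is at most $\pi/2$ times its chord. -/
theorem sq_phaseError_le (M : ℕ) (θ : ℝ) (j : Fin M) :
    phaseError M θ j ^ 2 ≤ Real.pi ^ 2 / 4 * (2 * (1 - Real.cos (θ - estimate M j))) := by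
  have h := Real.cos_le_one_sub_mul_cos_sq (x := phaseError M θ j)
    (Real.Angle.abs_toReal_le_pi _)
  rw [phaseError, Real.Angle.cos_toReal, Real.Angle.cos_coe] at h
  have hp : 0 < Real.pi ^ 2 := by positivity
  calc phaseError M θ j ^ 2 = Real.pi ^ 2 / 2 * (2 / Real.pi ^ 2 * phaseError M θ j ^ 2) := by
        field_simp
    _ ≤ Real.pi ^ 2 / 2 * (1 - Real.cos (θ - estimate M j)) := by
        gcongr
        rw [phaseError]
        linarith
    _ = _ := by ring

/-- The sines are the ordinates of two points on the unit circle, and the right side is their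
squared distance. -/
theorem sin_sub_sin_sq_le (x y : ℝ) :
    (Real.sin x - Real.sin y) ^ 2 ≤ 2 * (1 - Real.cos (x - y)) := by
  rw [Real.cos_sub]
  nlinarith [Real.sin_sq_add_cos_sq x, Real.sin_sq_add_cos_sq y,
    sq_nonneg (Real.cos x - Real.cos y)]

theorem selectPower_append_mulVec {κ : Type} [Fintype κ] [DecidableEq κ] (M : ℕ)
    (U : Matrix κ κ ℂ) (v : κ → ℂ) (p : κ × Fin M) :
    (selectPower M U * appendRegister κ (sineWindow M)).mulVec v p =
      sineWindow M p.2 * (U ^ (p.2 : ℕ)).mulVec v p.1 := by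
  rw [← Matrix.mulVec_mulVec]
  simp only [Matrix.mulVec, dotProduct, appendRegister, selectPower, Matrix.of_apply, ite_mul,
    zero_mul, Finset.sum_ite_eq, Finset.mem_univ, if_true, Fintype.sum_prod_type, Finset.mul_sum]
  refine Finset.sum_congr rfl fun k _ => ?_
  ring

theorem phaseEstimation_mulVec {κ : Type} [Fintype κ] [DecidableEq κ] (M : ℕ)
    (U : Matrix κ κ ℂ) (v : κ → ℂ) (p : κ × Fin M) :
    (phaseEstimation M U).mulVec v p =
      ∑ x, invFourier M p.2 x * (sineWindow M x * (U ^ (x : ℕ)).mulVec v p.1) := by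
  rw [phaseEstimation, Matrix.mul_assoc, ← Matrix.mulVec_mulVec]
  conv_lhs => rw [Matrix.mulVec, dotProduct]
  simp only [selectPower_append_mulVec, Fintype.sum_prod_type, Matrix.kroneckerMap_apply,
    Matrix.one_apply, ite_mul, one_mul, zero_mul]
  simp [Finset.sum_ite_irrel]

theorem pow_mulVec_of_eigenvector {κ : Type} [Fintype κ] [DecidableEq κ] {U : Matrix κ κ ℂ}
    {v : κ → ℂ} {z : ℂ} (h : U.mulVec v = z • v) (n : ℕ) : (U ^ n).mulVec v = z ^ n • v := by
  induction n with
  | zero => simp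
  | succ n ih =>
    rw [pow_succ, ← Matrix.mulVec_mulVec, h, Matrix.mulVec_smul, ih, smul_smul, pow_succ, mul_comm]

theorem phaseEstimation_mulVec_of_eigenvector {κ : Type} [Fintype κ] [DecidableEq κ] (M : ℕ)
    {U : Matrix κ κ ℂ} {v : κ → ℂ} {θ : ℝ} (h : U.mulVec v = Complex.exp (Complex.I * (θ : ℂ)) • v)
    (k : κ) (j : Fin M) :
    (phaseEstimation M U).mulVec v (k, j) = v k * phaseAmplitude M θ j := by
  simp only [phaseEstimation_mulVec, pow_mulVec_of_eigenvector h, phaseAmplitude]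
  simp only [Matrix.mulVec, dotProduct, Pi.smul_apply, smul_eq_mul, Finset.mul_sum]
  refine Finset.sum_congr rfl fun x _ => ?_
  ring

theorem mean_square_phaseError_le {κ : Type} [Fintype κ] [DecidableEq κ] (M : ℕ) (hM : 1 ≤ M)
    {U : Matrix κ κ ℂ} {v : κ → ℂ} {θ : ℝ} (hv : ∑ k, ‖v k‖ ^ 2 = 1)
    (h : U.mulVec v = Complex.exp (Complex.I * (θ : ℂ)) • v) :
    ∑ j, phaseError M θ j ^ 2 * outcomeProb M U v j ≤ 186 / (M : ℝ) ^ 2 := by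
  have hp : ∀ j, outcomeProb M U v j = ‖phaseAmplitude M θ j‖ ^ 2 := by
    intro j
    simp only [outcomeProb, phaseEstimation_mulVec_of_eigenvector M h, norm_mul, mul_pow]
    rw [← Finset.sum_mul, hv, one_mul]
  have hM0 : (0 : ℝ) < M := by exact_mod_cast hM
  have hpi := Real.pi_lt_d2
  have hpi2 : Real.pi ^ 2 ≤ 10 := by nlinarith [Real.pi_pos]
  calc ∑ j, phaseError M θ j ^ 2 * outcomeProb M U v j
      ≤ ∑ j, Real.pi ^ 2 / 4 * (2 * (1 - Real.cos (θ - estimate M j)) *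
          ‖phaseAmplitude M θ j‖ ^ 2) := by
        refine Finset.sum_le_sum fun j _ => ?_
        rw [hp, ← mul_assoc]
        gcongr
        exact sq_phaseError_le M θ j
    _ ≤ Real.pi ^ 2 / 4 * (4 * Real.pi ^ 2 / ((M : ℝ) + 1) ^ 2) := by
        rw [← Finset.mul_sum]
        gcongr
        exact sum_chord_sq_mul_phaseAmplitude_le M hM θ
    _ = (Real.pi ^ 2) ^ 2 / ((M : ℝ) + 1) ^ 2 := by ring
    -- Since $\pi^2\le10$, the numerator is at most $100$; the constant $186$ leaves room.
    _ ≤ 186 / (M : ℝ) ^ 2 := by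
        gcongr
        · nlinarith [sq_nonneg Real.pi]
        · linarith

/-! ### Norms of nonnegative matrices -/

theorem opNorm_nonneg {ι : Type} [Fintype ι] [DecidableEq ι] (A : Matrix ι ι ℝ) : 0 ≤ opNorm A :=
  norm_nonneg _

theorem norm_mulVec_le_opNorm {ι : Type} [Fintype ι] [DecidableEq ι] (A : Matrix ι ι ℝ)
    (x : ι → ℝ) : ‖WithLp.toLp 2 (A.mulVec x)‖ ≤ opNorm A * ‖WithLp.toLp 2 x‖ := by
  rw [← Matrix.toEuclideanCLM_toLp]
  exact ContinuousLinearMap.le_opNorm _ _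

theorem norm_toLp_le_of_abs_le {ι : Type} [Fintype ι] {x y : ι → ℝ} (h : ∀ a, |x a| ≤ y a) :
    ‖WithLp.toLp 2 x‖ ≤ ‖WithLp.toLp 2 y‖ := by
  rw [EuclideanSpace.norm_eq, EuclideanSpace.norm_eq]
  gcongr with a
  exact (h a).trans (le_abs_self _)

theorem norm_toLp_abs {ι : Type} [Fintype ι] (x : ι → ℝ) :
    ‖WithLp.toLp 2 fun a => |x a|‖ = ‖WithLp.toLp 2 x‖ := by
  simp [EuclideanSpace.norm_eq]

theorem abs_mulVec_le {ι : Type} [Fintype ι] {A B : Matrix ι ι ℝ} (h : ∀ a b, |A a b| ≤ B a b)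
    (x : ι → ℝ) (a : ι) : |A.mulVec x a| ≤ B.mulVec (fun b => |x b|) a := by
  refine (Finset.abs_sum_le_sum_abs _ _).trans (Finset.sum_le_sum fun b _ => ?_)
  rw [abs_mul]
  gcongr
  exact h a b

theorem opNorm_le_of_abs_le {ι : Type} [Fintype ι] [DecidableEq ι] {A B : Matrix ι ι ℝ}
    (h : ∀ a b, |A a b| ≤ B a b) : opNorm A ≤ opNorm B := by
  refine ContinuousLinearMap.opNorm_le_bound _ (opNorm_nonneg B) fun x => ?_
  calc ‖Matrix.toEuclideanCLM (𝕜 := ℝ) A x‖ ≤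
        ‖WithLp.toLp 2 (B.mulVec fun b => |x b|)‖ := norm_toLp_le_of_abs_le (abs_mulVec_le h _)
    _ ≤ opNorm B * ‖WithLp.toLp 2 fun b => |x b|‖ := norm_mulVec_le_opNorm _ _
    _ = opNorm B * ‖x‖ := by rw [norm_toLp_abs]

theorem abs_apply_le_opNorm {ι : Type} [Fintype ι] [DecidableEq ι] (A : Matrix ι ι ℝ) (a b : ι) :
    |A a b| ≤ opNorm A := by
  have h := norm_mulVec_le_opNorm A (Pi.single b 1)
  have h2 := PiLp.norm_apply_le (WithLp.toLp 2 (A.mulVec (Pi.single b 1))) a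
  simp only [Matrix.mulVec_single_one, Matrix.col_apply, Real.norm_eq_abs] at h h2
  have h3 : ‖WithLp.toLp 2 (Pi.single b (1 : ℝ) : ι → ℝ)‖ = 1 := by
    simp
  rw [h3, mul_one] at h
  exact h2.trans h

theorem opNorm_add_smul_one_le {ι : Type} [Fintype ι] [DecidableEq ι] (A : Matrix ι ι ℝ) {c : ℝ}
    (hc : 0 ≤ c) : opNorm (A + c • (1 : Matrix ι ι ℝ)) ≤ opNorm A + c := by
  rw [opNorm, map_add, map_smul, map_one]
  refine (norm_add_le _ _).trans ?_
  gcongr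
  · exact le_rfl
  · rw [norm_smul, Real.norm_of_nonneg hc]
    exact mul_le_of_le_one_right hc ContinuousLinearMap.norm_id_le

/-! ### Perron–Frobenius for symmetric matrices -/

/-- Compactness of the sphere gives a maximizer. Taking absolute values of its entries keeps its
norm and, as $B\ge0$, does not decrease the norm of its image. -/
theorem exists_nonneg_norm_attaining {ι : Type} [Fintype ι] [DecidableEq ι] [Nonempty ι]
    {B : Matrix ι ι ℝ} (hB : ∀ a b, 0 ≤ B a b) :
    ∃ z : ι → ℝ, (∀ a, 0 ≤ z a) ∧ ‖WithLp.toLp 2 z‖ = 1 ∧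
      ‖WithLp.toLp 2 (B.mulVec z)‖ = opNorm B := by
  obtain ⟨y, hy, hmax⟩ := (isCompact_sphere (0 : EuclideanSpace ℝ ι) 1).exists_isMaxOn
    (NormedSpace.sphere_nonempty.2 zero_le_one)
    (f := fun y => ‖Matrix.toEuclideanCLM (𝕜 := ℝ) B y‖) (by fun_prop)
  have hy1 : ‖y‖ = 1 := by simpa using hy
  have hle : opNorm B ≤ ‖Matrix.toEuclideanCLM (𝕜 := ℝ) B y‖ := by
    refine ContinuousLinearMap.opNorm_le_of_unit_norm (norm_nonneg _) fun x hx => ?_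
    exact hmax (by simpa using hx)
  have hz1 : ‖WithLp.toLp 2 fun a => |y a|‖ = 1 := by
    rw [norm_toLp_abs]
    exact hy1
  refine ⟨fun a => |y a|, fun a => abs_nonneg _, hz1, le_antisymm ?_ ?_⟩
  · simpa [hz1] using norm_mulVec_le_opNorm B fun a => |y a|
  · exact hle.trans (norm_toLp_le_of_abs_le
      (abs_mulVec_le (fun a b => (abs_of_nonneg (hB a b)).le) _))

/-- A norm-attaining $z\ge0$ is an eigenvector of $B^2$ for $r^2$, but $B$ may also have the
eigenvalue $-r$. The vector $Bz+rz$ removes that part, and it stays nonnegative and nonzero. -/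
theorem exists_nonneg_eigenvector {ι : Type} [Fintype ι] [DecidableEq ι] [Nonempty ι]
    {B : Matrix ι ι ℝ} (hB : ∀ a b, 0 ≤ B a b) (hsymm : ∀ a b, B a b = B b a) (hr : 0 < opNorm B) :
    ∃ x : ι → ℝ, (∀ a, 0 ≤ x a) ∧ (∃ a, 0 < x a) ∧ B.mulVec x = opNorm B • x := by
  obtain ⟨z, hz, hz1, hBz⟩ := exists_nonneg_norm_attaining hB
  set r := opNorm B with hrdef
  have hBT : B.transpose = B := by
    ext a b
    exact hsymm b a
  -- Equality in Cauchy–Schwarz: $\langle B^2z,z\rangle=\|Bz\|^2=r^2$ and $\|B^2z\|\le r^2$, so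
  -- $\|B^2z-r^2z\|^2\le r^4-2r^4+r^4=0$.
  have hsq : B.mulVec (B.mulVec z) = r ^ 2 • z := by
    have hinner : inner ℝ (WithLp.toLp 2 (B.mulVec (B.mulVec z))) (WithLp.toLp 2 (r ^ 2 • z)) =
        r ^ 4 := by
      have h1 : inner ℝ (WithLp.toLp 2 (B.mulVec (B.mulVec z))) (WithLp.toLp 2 z) =
          inner ℝ (WithLp.toLp 2 (B.mulVec z)) (WithLp.toLp 2 (B.mulVec z)) := by
        simp only [EuclideanSpace.inner_toLp_toLp, star_trivial]
        rw [Matrix.dotProduct_mulVec, ← Matrix.mulVec_transpose, hBT]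
      rw [WithLp.toLp_smul, inner_smul_right, h1, real_inner_self_eq_norm_sq, hBz]
      ring
    have hn : ‖WithLp.toLp 2 (B.mulVec (B.mulVec z))‖ ≤ r ^ 2 := by
      refine (norm_mulVec_le_opNorm B _).trans ?_
      rw [hBz, ← hrdef, sq]
    have hn2 : ‖WithLp.toLp 2 (r ^ 2 • z)‖ = r ^ 2 := by
      rw [WithLp.toLp_smul, norm_smul, hz1, mul_one, Real.norm_of_nonneg (by positivity)]
    have h0 : ‖WithLp.toLp 2 (B.mulVec (B.mulVec z)) - WithLp.toLp 2 (r ^ 2 • z)‖ ^ 2 ≤ 0 := by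
      rw [norm_sub_sq_real, hinner, hn2]
      have : ‖WithLp.toLp 2 (B.mulVec (B.mulVec z))‖ ^ 2 ≤ (r ^ 2) ^ 2 := by gcongr
      nlinarith
    have h1 := pow_eq_zero_iff two_ne_zero |>.1 (le_antisymm h0 (sq_nonneg _))
    exact WithLp.toLp_injective 2 (sub_eq_zero.1 (norm_eq_zero.1 h1))
  have hBz0 : ∀ a, 0 ≤ B.mulVec z a := fun a =>
    Finset.sum_nonneg fun b _ => mul_nonneg (hB a b) (hz b)
  refine ⟨B.mulVec z + r • z, fun a => ?_, ?_, ?_⟩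
  · exact add_nonneg (hBz0 a) (mul_nonneg hr.le (hz a))
  · have : ∃ a, z a ≠ 0 := by
      by_contra! h
      have : z = 0 := funext h
      simp [this] at hz1
    obtain ⟨a, ha⟩ := this
    exact ⟨a, add_pos_of_nonneg_of_pos (hBz0 a) (mul_pos hr ((hz a).lt_of_ne' ha))⟩
  · rw [Matrix.mulVec_add, hsq, Matrix.mulVec_smul, smul_add, smul_smul, sq, add_comm]

open Classical in
/-- The block of `abs(H)` on the component of `j`, padded with zeros. -/
def componentBlock {ι : Type} (H : Matrix ι ι ℂ) (j : ι) : Matrix ι ι ℝ :=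
  Matrix.of fun a b : ι =>
    if (hamGraph H).Reachable j a ∧ (hamGraph H).Reachable j b then absMatrix H a b else 0

theorem componentNorm_eq {ι : Type} [Fintype ι] [DecidableEq ι] (H : Matrix ι ι ℂ) (j : ι) :
    componentNorm H j = opNorm (componentBlock H j) := by
  unfold componentNorm componentBlock
  congr!

theorem componentBlock_eq_of_reachable {ι : Type} {H : Matrix ι ι ℂ} {j k : ι}
    (h : (hamGraph H).Reachable j k) : componentBlock H j = componentBlock H k := by
  have : ∀ a, (hamGraph H).Reachable j a ↔ (hamGraph H).Reachable k a := fun a =>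
    ⟨h.symm.trans, h.trans⟩
  ext a b
  classical exact if_congr (and_congr (this a) (this b)) rfl rfl

theorem componentNorm_eq_of_reachable {ι : Type} [Fintype ι] {H : Matrix ι ι ℂ} {j k : ι}
    (h : (hamGraph H).Reachable j k) : componentNorm H j = componentNorm H k := by
  classical
  rw [componentNorm_eq, componentNorm_eq, componentBlock_eq_of_reachable h]

theorem reachable_of_apply_ne_zero {ι : Type} {H : Matrix ι ι ℂ} {j k : ι} (h : H j k ≠ 0) :
    (hamGraph H).Reachable j k := by
  by_cases hjk : j = k
  · rw [hjk]
  · refine SimpleGraph.Adj.reachable ?_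
    rw [hamGraph, SimpleGraph.fromRel_adj]
    exact ⟨hjk, Or.inl h⟩

theorem componentNorm_nonneg {ι : Type} [Fintype ι] (H : Matrix ι ι ℂ) (j : ι) :
    0 ≤ componentNorm H j := by
  classical
  rw [componentNorm_eq]
  exact opNorm_nonneg _

theorem componentNorm_le {ι : Type} [Fintype ι] [DecidableEq ι] (H : Matrix ι ι ℂ) (j : ι) :
    componentNorm H j ≤ opNorm (absMatrix H) := by
  rw [componentNorm_eq]
  refine opNorm_le_of_abs_le fun a b => ?_
  simp only [componentBlock, Matrix.of_apply, absMatrix]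
  split_ifs <;> simp

theorem componentNorm_eq_opNorm_of_connected {ι : Type} [Fintype ι] [DecidableEq ι]
    {H : Matrix ι ι ℂ} (h : (hamGraph H).Connected) (j : ι) :
    componentNorm H j = opNorm (absMatrix H) := by
  rw [componentNorm_eq]
  congr 1
  ext a b
  simp [componentBlock, h.preconnected j a, h.preconnected j b]

/-- Entries of row $j$ that leave the component vanish, so only the values on the component matter.
This permits gluing the eigenvectors of the blocks. -/
theorem componentBlock_mulVec {ι : Type} [Fintype ι] {H : Matrix ι ι ℂ} {j : ι}
    (x y : ι → ℝ) (hxy : ∀ a, (hamGraph H).Reachable j a → x a = y a) :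
    (componentBlock H j).mulVec x j = (absMatrix H).mulVec y j := by
  refine Finset.sum_congr rfl fun b _ => ?_
  by_cases hb : (hamGraph H).Reachable j b
  · simp [componentBlock, hb, hxy b hb]
  · have : H j b = 0 := by
      by_contra h
      exact hb (reachable_of_apply_ne_zero h)
    simp [componentBlock, hb, absMatrix, this]

theorem norm_apply_comm {ι : Type} {H : Matrix ι ι ℂ} (hH : H.IsHermitian) (a b : ι) :
    ‖H a b‖ = ‖H b a‖ := by
  rw [← hH.apply a b, norm_star]

/-- For positive norm, the eigenvalue equation makes a nonnegative eigenvector vanish off the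
component, so it is positive somewhere on it. The same equation carries positivity across each edge.
If the norm is $0$, the block is $0$ and the constant vector serves. -/
theorem exists_pos_eigenvector_componentBlock {ι : Type} [Fintype ι] [DecidableEq ι]
    {H : Matrix ι ι ℂ} (hH : H.IsHermitian) (j : ι) :
    ∃ x : ι → ℝ, (∀ a, (hamGraph H).Reachable j a → 0 < x a) ∧
      (componentBlock H j).mulVec x = opNorm (componentBlock H j) • x := by
  have hB0 : ∀ a b, 0 ≤ componentBlock H j a b := by
    intro a b
    simp only [componentBlock, Matrix.of_apply, absMatrix]
    split_ifs <;> simp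
  have hBs : ∀ a b, componentBlock H j a b = componentBlock H j b a := by
    intro a b
    simp only [componentBlock, Matrix.of_apply, absMatrix, norm_apply_comm hH a b]
    by_cases ha : (hamGraph H).Reachable j a <;> by_cases hb : (hamGraph H).Reachable j b <;>
      simp [ha, hb]
  rcases (opNorm_nonneg (componentBlock H j)).eq_or_lt with h0 | hpos
  · refine ⟨fun _ => 1, fun _ _ => one_pos, ?_⟩
    have hz : componentBlock H j = 0 := by
      ext a b
      exact abs_nonpos_iff.1 ((abs_apply_le_opNorm _ a b).trans h0.symm.le)
    rw [← h0, hz]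
    simp
  · have : Nonempty ι := ⟨j⟩
    obtain ⟨x, hx0, ⟨a, ha⟩, hx⟩ := exists_nonneg_eigenvector hB0 hBs hpos
    refine ⟨x, ?_, hx⟩
    have hxa : ∀ b, opNorm (componentBlock H j) * x b = (componentBlock H j).mulVec x b := by
      intro b
      rw [hx]
      rfl
    have hja : (hamGraph H).Reachable j a := by
      by_contra hn
      have := hxa a
      have hz : (componentBlock H j).mulVec x a = 0 :=
        Finset.sum_eq_zero fun b _ => by simp [componentBlock, hn]
      rw [hz] at this
      exact (mul_pos hpos ha).ne' this
    have step : ∀ b c, (hamGraph H).Reachable j b → (hamGraph H).Adj b c → 0 < x b → 0 < x c := by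
      intro b c hjb hbc hb
      have hHcb : 0 < ‖H c b‖ := by
        rw [hamGraph, SimpleGraph.fromRel_adj] at hbc
        rcases hbc.2 with h | h
        · rw [norm_apply_comm hH]
          exact norm_pos_iff.2 h
        · exact norm_pos_iff.2 h
      have hle : componentBlock H j c b * x b ≤ (componentBlock H j).mulVec x c :=
        Finset.single_le_sum (f := fun b => componentBlock H j c b * x b)
          (fun b _ => mul_nonneg (hB0 c b) (hx0 b)) (Finset.mem_univ b)
      have hlt : 0 < componentBlock H j c b * x b := by
        refine mul_pos ?_ hb
        simpa [componentBlock, hjb, hjb.trans hbc.reachable, absMatrix] using hHcb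
      rw [← hxa] at hle
      exact (mul_pos_iff_of_pos_left hpos).1 (hlt.trans_le hle)
    intro b hjb
    obtain ⟨p⟩ := hja.symm.trans hjb
    have : ∀ u v (_ : (hamGraph H).Walk u v), (hamGraph H).Reachable j u → 0 < x u → 0 < x v := by
      intro u v q
      induction q with
      | nil => exact fun _ h => h
      | cons hadj _ ih => exact fun hj h => ih (hj.trans hadj.reachable) (step _ _ hj hadj h)
    exact this a b p hja ha

theorem exists_isPrincipal_componentNorm {ι : Type} [Fintype ι] [DecidableEq ι]
    {H : Matrix ι ι ℂ} (hH : H.IsHermitian) : ∃ d, IsPrincipal H (componentNorm H) d := by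
  choose x hpos hx using exists_pos_eigenvector_componentBlock hH
  -- All vertices of a component must use the same block eigenvector, hence a fixed representative
  -- of each component.
  let rep : ι → ι := fun j => ((hamGraph H).connectedComponentMk j).out
  have hrep : ∀ j, (hamGraph H).Reachable (rep j) j := fun j =>
    SimpleGraph.ConnectedComponent.exact (Quot.out_eq _)
  refine ⟨fun j => x (rep j) j, fun j => hpos _ _ (hrep j), fun j => ?_⟩
  rw [← componentBlock_mulVec (x (rep j)), ← componentBlock_eq_of_reachable (hrep j), hx,
    componentNorm_eq, componentBlock_eq_of_reachable (hrep j)]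
  · rfl
  · intro a ha
    have : rep j = rep a := by
      simp only [rep, SimpleGraph.ConnectedComponent.sound ha]
    rw [this]

/-! ### The shift of the energy -/

theorem hamGraph_shifted {ι : Type} [DecidableEq ι] (H : Matrix ι ι ℂ) :
    hamGraph (shifted H) = hamGraph H := by
  ext a b
  simp only [hamGraph, SimpleGraph.fromRel_adj, shifted]
  refine and_congr_right fun hab => ?_
  simp [hab, Ne.symm hab]

theorem energyShift_nonneg {ι : Type} (H : Matrix ι ι ℂ) : 0 ≤ energyShift H :=
  Real.iSup_nonneg fun _ => le_max_left _ _

theorem energyShift_le_opNorm {ι : Type} [Fintype ι] [DecidableEq ι] (H : Matrix ι ι ℂ) :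
    energyShift H ≤ opNorm (absMatrix H) := by
  refine Real.iSup_le (fun j => max_le (opNorm_nonneg _) ?_) (opNorm_nonneg _)
  calc -(H j j).re ≤ ‖H j j‖ := (neg_le_abs _).trans (Complex.abs_re_le_norm _)
    _ ≤ |absMatrix H j j| := le_abs_self _
    _ ≤ _ := abs_apply_le_opNorm _ _ _

theorem isHermitian_shifted {ι : Type} [DecidableEq ι] {H : Matrix ι ι ℂ} (hH : H.IsHermitian) :
    (shifted H).IsHermitian := by
  refine hH.add ?_
  rw [Matrix.IsHermitian, Matrix.conjTranspose_smul, Matrix.conjTranspose_one]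
  simp

theorem shifted_diag_re_nonneg {ι : Type} [Finite ι] [DecidableEq ι] (H : Matrix ι ι ℂ) (j : ι) :
    0 ≤ (shifted H j j).re := by
  have : -(H j j).re ≤ energyShift H :=
    (le_max_right 0 _).trans (le_ciSup (f := fun j => max 0 (-(H j j).re))
      (Set.finite_range _).bddAbove j)
  simp [shifted]
  linarith

/-- The shift is at most the largest $|H_{jj}|$, hence at most the norm itself. -/
theorem opNorm_absMatrix_shifted_le {ι : Type} [Fintype ι] [DecidableEq ι] (H : Matrix ι ι ℂ) :
    opNorm (absMatrix (shifted H)) ≤ 2 * opNorm (absMatrix H) := by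
  have hc := energyShift_nonneg H
  calc opNorm (absMatrix (shifted H))
      ≤ opNorm (absMatrix H + energyShift H • (1 : Matrix ι ι ℝ)) := by
        refine opNorm_le_of_abs_le fun a b => ?_
        simp only [absMatrix, shifted, Matrix.of_apply, Matrix.add_apply, Matrix.smul_apply,
          abs_norm]
        refine (norm_add_le _ _).trans ?_
        gcongr
        by_cases hab : a = b <;> simp [hab, abs_of_nonneg hc, Matrix.one_apply]
    _ ≤ opNorm (absMatrix H) + energyShift H := opNorm_add_smul_one_le _ hc
    _ ≤ _ := by linarith [energyShift_le_opNorm H]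

/-! ### Consistent square roots -/

/-- Off the diagonal a root is chosen above it and conjugated below. On the diagonal consistency
forces a real root, which is where $H_{jj}\ge0$ enters. -/
theorem exists_isRootChoice {N : ℕ} {H : Matrix (Fin N) (Fin N) ℂ} (hH : H.IsHermitian)
    (hdiag : ∀ j, 0 ≤ (H j j).re) : ∃ s, IsRootChoice H s := by
  have hroot : ∀ z : ℂ, ∃ w : ℂ, w ^ 2 = z := fun z => IsAlgClosed.exists_pow_nat_eq z two_pos
  choose q hq using hroot
  refine ⟨fun j k => if j < k then q (star (H j k)) else if k < j then star (q (star (H k j)))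
    else ((Real.sqrt (H j j).re : ℝ) : ℂ), fun j k => ?_⟩
  rcases lt_trichotomy j k with h | h | h
  · simp [h, h.not_gt, hq]
  · subst h
    have him : (H j j).im = 0 := Complex.conj_eq_iff_im.1 (hH.apply j j)
    refine ⟨?_, by simp⟩
    simp only [lt_self_iff_false, if_false]
    rw [← Complex.ofReal_pow, Real.sq_sqrt (hdiag j), hH.apply]
    exact Complex.ext (by simp) (by simp [him])
  · simp only [h, h.not_gt, if_true, if_false, star_star, and_true]
    rw [← star_pow, hq, star_star, hH.apply]

/-! ### The walk -/

/-- The states $\psi_j$ are supported on pairs of equal rate. This lets the different components run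
side by side. -/
theorem walkState_ne_zero {ι : Type} [DecidableEq ι] {K : Matrix ι ι ℂ} {r d : ι → ℝ}
    {s : ι → ι → ℂ} (hs : IsRootChoice K s) (hr : ∀ j k, K j k ≠ 0 → r j = r k) {j : ι}
    {p : ι × ι} (h : walkState r d s j p ≠ 0) : p.1 = j ∧ r p.2 = r j := by
  unfold walkState at h
  split_ifs at h with h1 h2 h3
  · subst h2
    exact ⟨rfl, rfl⟩
  · exact absurd rfl h
  · refine ⟨h3, (hr _ _ fun h0 => h ?_).symm⟩
    have := (hs j p.2).1
    rw [h0, star_zero, sq_eq_zero_iff] at this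
    simp [this]
  · exact absurd rfl h

theorem walkState_eq_zero_of_fst_ne {ι : Type} [DecidableEq ι] {r d : ι → ℝ}
    {s : ι → ι → ℂ} {j : ι} {p : ι × ι} (h : p.1 ≠ j) : walkState r d s j p = 0 := by
  unfold walkState
  split_ifs with h1 h2
  · subst h2
    exact absurd rfl h
  · rfl
  · rfl

theorem norm_rootChoice_sq {ι : Type} {K : Matrix ι ι ℂ} {s : ι → ι → ℂ} (hs : IsRootChoice K s)
    (j k : ι) : ‖s j k‖ ^ 2 = ‖K j k‖ := by
  rw [← norm_pow, (hs j k).1, norm_star]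

/-- Normalization is exactly the eigenvector equation $\sum_k|K_{jk}|d_k=r_jd_j$. -/
theorem sum_norm_sq_walkState {ι : Type} [Fintype ι] [DecidableEq ι] {K : Matrix ι ι ℂ}
    {r d : ι → ℝ} {s : ι → ι → ℂ} (hd : IsPrincipal K r d) (hs : IsRootChoice K s)
    (hr0 : ∀ j, 0 ≤ r j) (j : ι) : ∑ k, ‖walkState r d s j (j, k)‖ ^ 2 = 1 := by
  by_cases hj : r j = 0
  · simp [walkState, hj, Prod.ext_iff, apply_ite]
  · have hdj := hd.1 j
    have h : ∀ k, ‖walkState r d s j (j, k)‖ ^ 2 = (r j * d j)⁻¹ * (absMatrix K j k * d k) := by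
      intro k
      have hdk := hd.1 k
      simp only [walkState, if_neg hj, if_true, norm_mul, norm_inv, Complex.norm_real,
        Real.norm_of_nonneg (Real.sqrt_nonneg _), mul_pow, inv_pow, norm_rootChoice_sq hs,
        Real.sq_sqrt (hr0 j), Real.sq_sqrt (div_pos hdk hdj).le, absMatrix, Matrix.of_apply]
      field_simp
    simp only [h]
    rw [← Finset.mul_sum]
    have := hd.2 j
    rw [Matrix.mulVec, dotProduct] at this
    rw [this]
    field_simp

theorem walkIsometry_conjTranspose_mul_self {ι : Type} [Fintype ι] [DecidableEq ι]
    {K : Matrix ι ι ℂ} {r d : ι → ℝ} {s : ι → ι → ℂ} (hd : IsPrincipal K r d)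
    (hs : IsRootChoice K s) (hr0 : ∀ j, 0 ≤ r j) :
    (walkIsometry r d s).conjTranspose * walkIsometry r d s = 1 := by
  ext i j
  simp only [Matrix.mul_apply, Matrix.conjTranspose_apply, walkIsometry, Matrix.of_apply]
  by_cases hij : i = j
  · subst hij
    rw [Matrix.one_apply_eq, Fintype.sum_prod_type, Finset.sum_eq_single i]
    · simp only [RCLike.star_def, Complex.conj_mul']
      exact_mod_cast sum_norm_sq_walkState hd hs hr0 i
    · intro a _ ha
      simp [walkState_eq_zero_of_fst_ne (p := (a, _)) ha]
    · simp
  · rw [Matrix.one_apply_ne hij]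
    refine Finset.sum_eq_zero fun p _ => ?_
    by_cases hp : p.1 = i
    · rw [walkState_eq_zero_of_fst_ne (j := j) (hp ▸ hij), mul_zero]
    · rw [walkState_eq_zero_of_fst_ne hp, star_zero, zero_mul]

theorem swapMatrix_mul_apply {ι μ : Type} [Fintype ι] [DecidableEq ι] (A : Matrix (ι × ι) μ ℂ)
    (p : ι × ι) (j : μ) : (swapMatrix ι * A) p j = A p.swap j := by
  have : ∀ q : ι × ι, p = q.swap ↔ p.swap = q := fun q =>
    ⟨fun h => by rw [h, Prod.swap_swap], fun h => by rw [← h, Prod.swap_swap]⟩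
  simp [Matrix.mul_apply, swapMatrix, this]

theorem swapMatrix_conjTranspose (ι : Type) [DecidableEq ι] :
    (swapMatrix ι).conjTranspose = swapMatrix ι := by
  ext p q
  have : q = p.swap ↔ p = q.swap :=
    ⟨fun h => by rw [h, Prod.swap_swap], fun h => by rw [h, Prod.swap_swap]⟩
  simp only [swapMatrix, Matrix.conjTranspose_apply, Matrix.of_apply, this]
  split_ifs <;> simp

theorem swapMatrix_mul_self (ι : Type) [Fintype ι] [DecidableEq ι] :
    swapMatrix ι * swapMatrix ι = 1 := by
  ext p q
  rw [swapMatrix_mul_apply]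
  simp [swapMatrix, Matrix.one_apply, Prod.swap_inj]

/-- The walk represents the Hamiltonian: `r_j (T† S T)_jk = H_jk`. -/
theorem diagonal_mul_walkIsometry_swap {ι : Type} [Fintype ι] [DecidableEq ι]
    {K : Matrix ι ι ℂ} {r d : ι → ℝ} {s : ι → ι → ℂ} (hd : IsPrincipal K r d)
    (hs : IsRootChoice K s) (hr0 : ∀ j, 0 ≤ r j) (hr : ∀ j k, K j k ≠ 0 → r j = r k) :
    Matrix.diagonal (fun j => (r j : ℂ)) *
      ((walkIsometry r d s).conjTranspose * (swapMatrix ι * walkIsometry r d s)) = K := by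
  ext j k
  rw [Matrix.diagonal_mul, Matrix.mul_apply]
  simp only [swapMatrix_mul_apply, Matrix.conjTranspose_apply, walkIsometry, Matrix.of_apply]
  -- $\psi_j$ lives on pairs with first entry $j$ and $S\psi_k$ on pairs with second entry $k$.
  rw [Finset.sum_eq_single (j, k)]
  · by_cases hK : K j k = 0
    · rw [hK]
      by_cases hj : r j = 0
      -- For an isolated $j$ with $K_{jj}=0$ the convention makes $(T^\dagger ST)_{jj}=1$; the
      -- factor $r_j=0$ removes it.
      · simp [hj]
      · have hsjk : s j k = 0 := by
          have := (hs j k).1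
          rwa [hK, star_zero, sq_eq_zero_iff] at this
        simp [walkState, hj, hsjk]
    · have hjk := hr j k hK
      have hj : r j ≠ 0 := by
        intro h0
        have h1 := hd.2 j
        rw [h0, zero_mul, Matrix.mulVec, dotProduct, Finset.sum_eq_zero_iff_of_nonneg] at h1
        · have := h1 k (Finset.mem_univ k)
          simp [absMatrix, hK, (hd.1 k).ne'] at this
        · intro i _
          exact mul_nonneg (norm_nonneg (K j i)) (hd.1 i).le
      have hdj := hd.1 j
      have hdk := hd.1 k
      have hdd : Real.sqrt (d k / d j) * Real.sqrt (d j / d k) = 1 := by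
        rw [← Real.sqrt_mul (div_pos hdk hdj).le]
        field_simp
        simp
      have hrr : (r j : ℂ) * (((Real.sqrt (r j) : ℝ) : ℂ)⁻¹ * ((Real.sqrt (r j) : ℝ) : ℂ)⁻¹) =
          1 := by
        rw [← mul_inv, ← Complex.ofReal_mul, Real.mul_self_sqrt (hr0 j)]
        exact mul_inv_cancel₀ (by exact_mod_cast hj)
      -- Here the consistent choice of branches is used; the ratios of $d$ cancel separately.
      have hss : star (s j k) * s k j = K j k := by
        rw [(hs j k).2, ← sq, ← star_pow, (hs j k).1, star_star]
      simp only [walkState, if_neg hj, Prod.fst_swap, Prod.snd_swap, if_true, ← hjk]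
      simp only [star_mul', star_inv₀, RCLike.star_def, Complex.conj_ofReal] at hss ⊢
      calc _ = (r j : ℂ) * (((Real.sqrt (r j) : ℝ) : ℂ)⁻¹ * ((Real.sqrt (r j) : ℝ) : ℂ)⁻¹) *
            ((starRingEnd ℂ) (s j k) * s k j) *
            ((Real.sqrt (d k / d j) * Real.sqrt (d j / d k) : ℝ) : ℂ) := by
            push_cast
            ring
        _ = _ := by rw [hrr, hss, hdd]; simp
  · intro p _ hp
    by_cases h1 : p.1 = j
    · have h2 : p.swap.1 ≠ k := fun h2 => hp (Prod.ext h1 h2)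
      rw [walkState_eq_zero_of_fst_ne h2, mul_zero]
    · rw [walkState_eq_zero_of_fst_ne h1, star_zero, zero_mul]
  · simp

/-- Up to the phase $i$, the walk is a product of two Hermitian involutions. -/
theorem walk_mem_unitaryGroup {ι : Type} [Fintype ι] [DecidableEq ι]
    {T : Matrix (ι × ι) ι ℂ} (hT : T.conjTranspose * T = 1) :
    walk T ∈ Matrix.unitaryGroup (ι × ι) ℂ := by
  have hG : ((2 : ℂ) • (T * T.conjTranspose) - 1).conjTranspose =
      (2 : ℂ) • (T * T.conjTranspose) - 1 := by
    simp [Matrix.conjTranspose_sub, Matrix.conjTranspose_smul, Matrix.conjTranspose_mul]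
  have hPP : T * T.conjTranspose * (T * T.conjTranspose) = T * T.conjTranspose := by
    rw [Matrix.mul_assoc, ← Matrix.mul_assoc T.conjTranspose, hT, Matrix.one_mul]
  have hGG : ((2 : ℂ) • (T * T.conjTranspose) - 1) * ((2 : ℂ) • (T * T.conjTranspose) - 1) = 1 := by
    rw [sub_mul, mul_sub, smul_mul_smul_comm, hPP, mul_one, one_mul]
    module
  rw [Matrix.mem_unitaryGroup_iff', Matrix.star_eq_conjTranspose, walk,
    Matrix.conjTranspose_smul, Matrix.conjTranspose_mul, hG, swapMatrix_conjTranspose,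
    smul_mul_smul_comm, Matrix.mul_assoc, ← Matrix.mul_assoc (swapMatrix ι), swapMatrix_mul_self,
    Matrix.one_mul, hGG]
  simp

/-- The operator `(U - U†) / 2i`; on eigenvectors of `U` with eigenphase `θ` it is `sin θ`. -/
def phaseSine {κ : Type} (U : Matrix κ κ ℂ) : Matrix κ κ ℂ :=
  (-(Complex.I / 2)) • (U - U.conjTranspose)

/-- The reflection fixes the range of $T$, so $UT=iST$ and $U^\dagger T=-i(2TT^\dagger ST-ST)$. In
the difference the terms $ST$, which leave the range, cancel. -/
theorem phaseSine_walk_mul {ι : Type} [Fintype ι] [DecidableEq ι]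
    {T : Matrix (ι × ι) ι ℂ} (hT : T.conjTranspose * T = 1) :
    phaseSine (walk T) * T = T * (T.conjTranspose * (swapMatrix ι * T)) := by
  have h1 : walk T * T = Complex.I • (swapMatrix ι * T) := by
    rw [walk, Matrix.smul_mul, Matrix.mul_assoc, Matrix.sub_mul, Matrix.smul_mul, Matrix.mul_assoc T,
      hT, Matrix.mul_one, Matrix.one_mul]
    congr 2
    module
  have h2 : (walk T).conjTranspose * T = (-Complex.I) •
      ((2 : ℂ) • (T * (T.conjTranspose * (swapMatrix ι * T))) - swapMatrix ι * T) := by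
    simp only [walk, Matrix.conjTranspose_smul, Matrix.conjTranspose_mul, swapMatrix_conjTranspose,
      Matrix.conjTranspose_sub, Matrix.conjTranspose_conjTranspose, Matrix.conjTranspose_one,
      Matrix.smul_mul, Matrix.sub_mul, Matrix.one_mul, Matrix.mul_assoc, RCLike.star_def,
      Complex.conj_I, map_ofNat]
  rw [phaseSine, Matrix.smul_mul, Matrix.sub_mul, h1, h2]
  generalize T * (T.conjTranspose * (swapMatrix ι * T)) = A
  generalize swapMatrix ι * T = B
  have h3 : Complex.I • B - (-Complex.I) • ((2 : ℂ) • A - B) = (2 * Complex.I) • A := by module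
  have h4 : -(Complex.I / 2) * (2 * Complex.I) = 1 := by
    linear_combination (-1 : ℂ) * Complex.I_mul_I
  rw [h3, smul_smul, h4, one_smul]

/-- Swap-invariant diagonal operators that commute with the walk isometry commute with the walk. -/
theorem diagonal_commute_walk {ι : Type} [Fintype ι] [DecidableEq ι]
    {T : Matrix (ι × ι) ι ℂ} {f : ι × ι → ℝ} {g : ι → ℝ} (hf : ∀ p, f p.swap = f p)
    (hfT : ∀ p j, T p j ≠ 0 → f p = g j) :
    Commute (Matrix.diagonal fun p => (f p : ℂ)) (walk T) := by
  have h1 : Commute (Matrix.diagonal fun p => (f p : ℂ)) (swapMatrix ι) := by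
    ext p q
    rw [Matrix.diagonal_mul, Matrix.mul_diagonal, swapMatrix, Matrix.of_apply]
    split_ifs with h
    · rw [h, hf, mul_comm]
    · simp
  have h2 : Commute (Matrix.diagonal fun p => (f p : ℂ)) (T * T.conjTranspose) := by
    ext p q
    rw [Matrix.diagonal_mul, Matrix.mul_diagonal, Matrix.mul_apply, Finset.mul_sum, Finset.sum_mul]
    refine Finset.sum_congr rfl fun j _ => ?_
    by_cases hp : T p j = 0
    · simp [hp]
    by_cases hq : T q j = 0
    · simp [hq]
    · rw [hfT p j hp, hfT q j hq, mul_comm]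
  exact (h1.mul_right ((h2.smul_right _).sub_right (Commute.one_right _))).smul_right _

/-- The rate `r` on the pairs `|j,k⟩` with `r j = r k`, and zero elsewhere. -/
def pairRate {ι : Type} (r : ι → ℝ) (p : ι × ι) : ℝ := if r p.1 = r p.2 then r p.1 else 0

theorem pairRate_swap {ι : Type} (r : ι → ℝ) (p : ι × ι) : pairRate r p.swap = pairRate r p := by
  by_cases h : r p.1 = r p.2 <;> simp [pairRate, h, eq_comm (a := r p.2)]

/-- The indicator of the pairs `|j,k⟩` with `r j = r k`. -/
def pairIndicator {ι : Type} (r : ι → ℝ) (p : ι × ι) : ℝ := if r p.1 = r p.2 then 1 else 0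

theorem pairIndicator_swap {ι : Type} (r : ι → ℝ) (p : ι × ι) :
    pairIndicator r p.swap = pairIndicator r p := by
  by_cases h : r p.1 = r p.2 <;> simp [pairIndicator, h, eq_comm (a := r p.2)]

theorem walk_pow_mul_apply_eq_zero {ι : Type} [Fintype ι] [DecidableEq ι]
    {T : Matrix (ι × ι) ι ℂ} {r : ι → ℝ} (hT : ∀ p j, T p j ≠ 0 → r p.1 = r p.2) (n : ℕ)
    (ψ : ι → ℂ) {p : ι × ι} (hp : r p.1 ≠ r p.2) : (walk T ^ n).mulVec (T.mulVec ψ) p = 0 := by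
  have hfT : ∀ q j, T q j ≠ 0 → pairIndicator r q = (fun _ => (1 : ℝ)) j := fun q j h => by
    simp [pairIndicator, hT q j h]
  have h1 := (diagonal_commute_walk (pairIndicator_swap r) hfT).pow_right n
  have h2 : (Matrix.diagonal fun p => (pairIndicator r p : ℂ)).mulVec (T.mulVec ψ) =
      T.mulVec ψ := by
    ext q
    rw [Matrix.mulVec_diagonal]
    by_cases hq : r q.1 = r q.2
    · simp [pairIndicator, hq]
    · have : ∀ j, T q j = 0 := fun j => by
        by_contra h
        exact hq (hT q j h)
      simp [Matrix.mulVec, dotProduct, this]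
  have h3 : (walk T ^ n).mulVec (T.mulVec ψ) =
      (Matrix.diagonal fun p => (pairIndicator r p : ℂ)).mulVec
        ((walk T ^ n).mulVec (T.mulVec ψ)) := by
    rw [Matrix.mulVec_mulVec _ _ (walk T ^ n), h1.eq, ← Matrix.mulVec_mulVec, h2]
  rw [h3, Matrix.mulVec_diagonal]
  simp [pairIndicator, hp]

/-- The gate reads the rate from the first vertex only, which is not swap-invariant. The walk
started in the range of $T$ never leaves the pairs of equal rate, so the invariant `pairRate` may
replace it. -/
theorem phaseGate_mulVec_phaseEstimation {ι : Type} [Fintype ι] [DecidableEq ι]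
    {T : Matrix (ι × ι) ι ℂ} {r : ι → ℝ} (hT : ∀ p j, T p j ≠ 0 → r p.1 = r p.2) (M : ℕ) (t : ℝ)
    (ψ : ι → ℂ) :
    (phaseGate M fun p => r p.1 * t).mulVec ((phaseEstimation M (walk T)).mulVec (T.mulVec ψ)) =
      (phaseGate M fun p => pairRate r p * t).mulVec
        ((phaseEstimation M (walk T)).mulVec (T.mulVec ψ)) := by
  ext p
  rw [phaseGate, phaseGate, Matrix.mulVec_diagonal, Matrix.mulVec_diagonal]
  by_cases hp : r p.1.1 = r p.1.2
  · simp [pairRate, hp]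
  · rw [phaseEstimation_mulVec]
    simp [walk_pow_mul_apply_eq_zero hT _ ψ hp]

theorem exp_mul_eq_mul_exp {κ μ : Type} [Fintype κ] [DecidableEq κ] [Fintype μ] [DecidableEq μ]
    {A : Matrix κ κ ℂ} {B : Matrix μ μ ℂ} {T : Matrix κ μ ℂ} (h : A * T = T * B) :
    NormedSpace.exp A * T = T * NormedSpace.exp B := by
  have hpow : ∀ n, A ^ n * T = T * B ^ n := by
    intro n
    induction n with
    | zero => simp
    | succ n ih => rw [pow_succ, Matrix.mul_assoc, h, ← Matrix.mul_assoc, ih, Matrix.mul_assoc,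
        ← pow_succ]
  have hasSum_exp : ∀ {ν : Type} [Fintype ν] [DecidableEq ν] (C : Matrix ν ν ℂ),
      HasSum (fun n : ℕ => ((n.factorial : ℂ)⁻¹) • C ^ n) (NormedSpace.exp C) := by
    intro ν _ _ C
    let _ : NormedRing (Matrix ν ν ℂ) := Matrix.linftyOpNormedRing
    let _ : NormedAlgebra ℂ (Matrix ν ν ℂ) := Matrix.linftyOpNormedAlgebra
    exact NormedSpace.exp_series_hasSum_exp' C
  have h1 : HasSum (fun n : ℕ => ((n.factorial : ℂ)⁻¹) • (A ^ n * T)) (NormedSpace.exp A * T) := by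
    simpa [Function.comp_def, Matrix.addMonoidHomMulRight] using
      (hasSum_exp A).map (Matrix.addMonoidHomMulRight T)
        (continuous_id.matrix_mul continuous_const)
  have h2 : HasSum (fun n : ℕ => ((n.factorial : ℂ)⁻¹) • (T * B ^ n)) (T * NormedSpace.exp B) := by
    simpa [Function.comp_def, Matrix.addMonoidHomMulLeft] using
      (hasSum_exp B).map (Matrix.addMonoidHomMulLeft T)
        (continuous_const.matrix_mul continuous_id)
  simp only [hpow] at h1
  exact h1.unique h2

/-! ### Joint eigenvectors of a unitary and a diagonal matrix -/

theorem norm_eigenvalue_eq_one_of_mem_unitaryGroup {κ : Type} [Fintype κ] [DecidableEq κ] {U : Matrix κ κ ℂ}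
    (hU : U ∈ Matrix.unitaryGroup κ ℂ) {v : κ → ℂ} (hv : v ≠ 0) {z : ℂ} (h : U.mulVec v = z • v) :
    ‖z‖ = 1 := by
  have h1 := sum_norm_sq_mulVec_of_isometry (Matrix.mem_unitaryGroup_iff'.1 hU) v
  simp only [h, Pi.smul_apply, smul_eq_mul, norm_mul, mul_pow] at h1
  rw [← Finset.mul_sum] at h1
  have h2 : 0 < ∑ k, ‖v k‖ ^ 2 := by
    obtain ⟨k, hk⟩ := Function.ne_iff.1 hv
    exact Finset.sum_pos' (fun _ _ => by positivity)
      ⟨k, Finset.mem_univ k, pow_pos (norm_pos_iff.2 hk) 2⟩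
  have h3 : ‖z‖ ^ 2 = 1 := mul_right_cancel₀ h2.ne' (h1.trans (one_mul _).symm)
  exact (pow_eq_one_iff_of_nonneg (norm_nonneg z) two_ne_zero).1 h3

theorem commute_toEuclideanLin {κ : Type} [Fintype κ] [DecidableEq κ] {A B : Matrix κ κ ℂ}
    (h : Commute A B) : Commute (Matrix.toEuclideanLin A) (Matrix.toEuclideanLin B) := by
  rw [Commute, SemiconjBy, Module.End.mul_eq_comp, Module.End.mul_eq_comp,
    ← Matrix.toLpLin_mul_same, ← Matrix.toLpLin_mul_same, h.eq]

/-- Simultaneous diagonalization of the commuting Hermitian matrices $U+U^\dagger$, $i(U-U^\dagger)$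
and the diagonal one; the first two recover $U$. Only nonzero components of $w$ are kept, so the
eigenvalues of $U$ have modulus $1$ and each $\rho_i$ is an actual value of $\tau$, hence inherits
its bounds. -/
theorem exists_joint_eigenvectors {κ : Type} [Fintype κ] [DecidableEq κ] {U : Matrix κ κ ℂ}
    (hU : U ∈ Matrix.unitaryGroup κ ℂ) {τ : κ → ℝ}
    (hτ : Commute (Matrix.diagonal fun p => (τ p : ℂ)) U) (w : κ → ℂ) :
    ∃ (I : Type) (_ : Fintype I) (_ : DecidableEq I) (v : I → κ → ℂ) (θ ρ : I → ℝ),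
      ∑ i, v i = w ∧ (∀ i k, i ≠ k → star (v i) ⬝ᵥ v k = 0) ∧
      (∀ i, U.mulVec (v i) = Complex.exp (Complex.I * (θ i : ℂ)) • v i) ∧
      (∀ i p, v i p ≠ 0 → τ p = ρ i) ∧ ∀ i, ∃ p, τ p = ρ i := by
  classical
  set D := Matrix.diagonal fun p => (τ p : ℂ) with hD
  have hDh : D.conjTranspose = D := by
    rw [hD, Matrix.diagonal_conjTranspose]
    congr 1
    ext p
    simp
  have hUU : Commute U U.conjTranspose := by
    have h1 := Matrix.mem_unitaryGroup_iff.1 hU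
    have h2 := Matrix.mem_unitaryGroup_iff'.1 hU
    exact h1.trans h2.symm
  have hDU : Commute D U.conjTranspose := by
    have := congrArg Matrix.conjTranspose hτ.eq
    rw [Matrix.conjTranspose_mul, Matrix.conjTranspose_mul, hDh] at this
    exact this.symm
  let A : Fin 3 → Matrix κ κ ℂ :=
    ![U + U.conjTranspose, Complex.I • (U - U.conjTranspose), D]
  have hAh : ∀ i, (A i).IsHermitian := by
    intro i
    fin_cases i
    · simp [A, Matrix.IsHermitian, Matrix.conjTranspose_add, add_comm]
    · simp only [A, Matrix.IsHermitian, Fin.mk_one, Matrix.cons_val_one, Matrix.cons_val_zero,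
        Matrix.conjTranspose_smul, Matrix.conjTranspose_sub, Matrix.conjTranspose_conjTranspose,
        RCLike.star_def, Complex.conj_I]
      module
    · exact hDh
  have h01 : Commute (U + U.conjTranspose) (Complex.I • (U - U.conjTranspose)) :=
    ((((Commute.refl U).sub_right hUU).add_left
      (hUU.symm.sub_right (Commute.refl _)))).smul_right _
  have h02 : Commute (U + U.conjTranspose) D := (hτ.add_right hDU).symm
  have h12 : Commute (Complex.I • (U - U.conjTranspose)) D := ((hτ.sub_right hDU).smul_right _).symm
  have hAc : ∀ i j, i ≠ j → Commute (A i) (A j) := by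
    intro i j hij
    fin_cases i <;> fin_cases j
    · exact absurd rfl hij
    · exact h01
    · exact h02
    · exact h01.symm
    · exact absurd rfl hij
    · exact h12
    · exact h02.symm
    · exact h12.symm
    · exact absurd rfl hij
  have hsym : ∀ i, (Matrix.toEuclideanLin (A i)).IsSymmetric := fun i =>
    Matrix.isSymmetric_toEuclideanLin_iff.2 (hAh i)
  have htop := LinearMap.IsSymmetric.iSup_iInf_eq_top_of_commute hsym
    (fun i j hij => commute_toEuclideanLin (hAc i j hij))
  have horth := LinearMap.IsSymmetric.orthogonalFamily_iInf_eigenspaces hsym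
  obtain ⟨f, hf, hsum⟩ := (Submodule.mem_iSup_iff_exists_finsupp _ (WithLp.toLp 2 w)).1
    (htop ▸ Submodule.mem_top)
  have heig : ∀ (γ : Fin 3 → ℂ) i, (A i).mulVec (f γ).ofLp = γ i • (f γ).ofLp := by
    intro γ i
    have h1 := Module.End.mem_eigenspace_iff.1 ((Submodule.mem_iInf _).1 (hf γ) i)
    exact congrArg WithLp.ofLp h1
  have hUeig : ∀ γ : Fin 3 → ℂ, U.mulVec (f γ).ofLp =
      ((γ 0 - Complex.I * γ 1) / 2) • (f γ).ofLp := by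
    intro γ
    have hUA : U = (1 / 2 : ℂ) • (A 0 - Complex.I • A 1) := by
      have : Complex.I • A 1 = -(U - U.conjTranspose) := by
        simp only [A, Matrix.cons_val_one, Matrix.cons_val_zero, smul_smul, Complex.I_mul_I,
          neg_smul, one_smul]
      rw [this]
      simp only [A, Matrix.cons_val_zero]
      module
    conv_lhs => rw [hUA]
    rw [Matrix.smul_mulVec, Matrix.sub_mulVec, Matrix.smul_mulVec, heig, heig]
    module
  have hne : ∀ γ ∈ f.support, (f γ).ofLp ≠ 0 := by
    intro γ hγ h
    refine Finsupp.mem_support_iff.1 hγ ?_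
    ext p
    exact congrFun h p
  have hDeig : ∀ (γ : Fin 3 → ℂ) p, (f γ).ofLp p ≠ 0 → (τ p : ℂ) = γ 2 := by
    intro γ p hp
    have h1 := congrFun (heig γ 2) p
    have h2 : A 2 = D := rfl
    rw [h2, hD, Matrix.mulVec_diagonal, Pi.smul_apply, smul_eq_mul] at h1
    exact mul_right_cancel₀ hp h1
  refine ⟨f.support, inferInstance, inferInstance, fun γ => (f γ).ofLp,
    fun γ => ((γ.1 0 - Complex.I * γ.1 1) / 2).arg, fun γ => (γ.1 2).re, ?_, ?_, ?_, ?_, ?_⟩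
  · have h1 : ∑ γ ∈ f.support, f γ = WithLp.toLp 2 w := hsum
    have h2 := congrArg WithLp.ofLp h1
    rw [WithLp.ofLp_sum] at h2
    refine Eq.trans ?_ h2
    exact Finset.sum_coe_sort f.support (fun γ => (f γ).ofLp)
  · intro γ δ hγδ
    have h1 := horth (fun h => hγδ (Subtype.ext h)) ⟨f γ, hf γ⟩ ⟨f δ, hf δ⟩
    simp only [Submodule.coe_subtypeₗᵢ, Submodule.coe_subtype] at h1
    rw [EuclideanSpace.inner_eq_star_dotProduct, dotProduct_comm] at h1
    exact h1
  · intro γ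
    rw [hUeig]
    congr 1
    have h1 := norm_eigenvalue_eq_one_of_mem_unitaryGroup hU (hne _ γ.2) (hUeig γ.1)
    have h2 := Complex.norm_mul_exp_arg_mul_I ((γ.1 0 - Complex.I * γ.1 1) / 2)
    rw [h1, Complex.ofReal_one, one_mul, mul_comm] at h2
    exact h2.symm
  · intro γ p hp
    exact congrArg Complex.re (hDeig γ.1 p hp)
  · intro γ
    obtain ⟨p, hp⟩ := Function.ne_iff.1 (hne _ γ.2)
    exact ⟨p, congrArg Complex.re (hDeig γ.1 p hp)⟩

/-! ### The fidelity of the simulation -/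

theorem phaseSine_mulVec_of_eigenvector {κ : Type} [Fintype κ] [DecidableEq κ]
    {U : Matrix κ κ ℂ} (hU : U ∈ Matrix.unitaryGroup κ ℂ) {v : κ → ℂ} {θ : ℝ}
    (h : U.mulVec v = Complex.exp (Complex.I * (θ : ℂ)) • v) :
    (phaseSine U).mulVec v = (Real.sin θ : ℂ) • v := by
  have h1 : U.conjTranspose.mulVec v = Complex.exp (-(Complex.I * (θ : ℂ))) • v := by
    have h2 := congrArg (U.conjTranspose.mulVec) h
    rw [Matrix.mulVec_mulVec, ← Matrix.star_eq_conjTranspose, Matrix.mem_unitaryGroup_iff'.1 hU,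
      Matrix.one_mulVec, Matrix.mulVec_smul] at h2
    rw [← Matrix.star_eq_conjTranspose, Complex.exp_neg, eq_inv_smul_iff₀ (Complex.exp_ne_zero _)]
    exact h2.symm
  rw [phaseSine, Matrix.smul_mulVec, Matrix.sub_mulVec, h, h1, ← sub_smul, smul_smul]
  congr 1
  rw [Complex.ofReal_sin, Complex.sin]
  ring_nf

theorem phaseGate_phaseEstimation_dotProduct {κ : Type} [Fintype κ] [DecidableEq κ] (M : ℕ)
    {U : Matrix κ κ ℂ} {τ : κ → ℝ} {v w : κ → ℂ} {θ η ρ : ℝ}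
    (hv : U.mulVec v = Complex.exp (Complex.I * (θ : ℂ)) • v)
    (hw : U.mulVec w = Complex.exp (Complex.I * (η : ℂ)) • w) (hρ : ∀ p, w p ≠ 0 → τ p = ρ) :
    star ((phaseEstimation M U).mulVec v) ⬝ᵥ
        (phaseGate M τ).mulVec ((phaseEstimation M U).mulVec w) =
      (star v ⬝ᵥ w) * ∑ j, star (phaseAmplitude M θ j) * phaseAmplitude M η j *
        Complex.exp (-(Complex.I * ((ρ * Real.sin (estimate M j) : ℝ) : ℂ))) := by
  simp only [dotProduct, phaseGate, Matrix.mulVec_diagonal, Fintype.sum_prod_type, Pi.star_apply,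
    phaseEstimation_mulVec_of_eigenvector M hv, phaseEstimation_mulVec_of_eigenvector M hw]
  rw [Finset.sum_mul]
  refine Finset.sum_congr rfl fun p _ => ?_
  rw [Finset.mul_sum]
  refine Finset.sum_congr rfl fun j _ => ?_
  by_cases hp : w p = 0
  · simp [hp]
  · rw [hρ p hp, star_mul']
    ring

/-- Taking real parts leaves the mean of $\cos(\rho(\sin\theta-\sin\phi_j))$. Then $\cos
y\ge1-y^2/2$ reduces it to the mean-square chord. -/
theorem re_sum_phase_ge (M : ℕ) (hM : 1 ≤ M) (θ ρ : ℝ) :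
    1 - 2 * Real.pi ^ 2 * ρ ^ 2 / ((M : ℝ) + 1) ^ 2 ≤
      (Complex.exp (Complex.I * ((ρ * Real.sin θ : ℝ) : ℂ)) *
        ∑ j, star (phaseAmplitude M θ j) * phaseAmplitude M θ j *
          Complex.exp (-(Complex.I * ((ρ * Real.sin (estimate M j) : ℝ) : ℂ)))).re := by
  have h : ∀ j, (Complex.exp (Complex.I * ((ρ * Real.sin θ : ℝ) : ℂ)) *
      (star (phaseAmplitude M θ j) * phaseAmplitude M θ j *
          Complex.exp (-(Complex.I * ((ρ * Real.sin (estimate M j) : ℝ) : ℂ))))).re =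
      ‖phaseAmplitude M θ j‖ ^ 2 * Real.cos (ρ * (Real.sin θ - Real.sin (estimate M j))) := by
    intro j
    rw [← Complex.exp_ofReal_mul_I_re, ← Complex.re_ofReal_mul]
    congr 1
    rw [RCLike.star_def, Complex.conj_mul', mul_left_comm, ← Complex.exp_add]
    push_cast
    congr 2
    ring
  rw [Finset.mul_sum, Complex.re_sum]
  simp only [h]
  calc 1 - 2 * Real.pi ^ 2 * ρ ^ 2 / ((M : ℝ) + 1) ^ 2
      = 1 - ρ ^ 2 / 2 * (4 * Real.pi ^ 2 / ((M : ℝ) + 1) ^ 2) := by ring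
    _ ≤ ∑ j, ‖phaseAmplitude M θ j‖ ^ 2 - ρ ^ 2 / 2 *
        ∑ j, 2 * (1 - Real.cos (θ - estimate M j)) * ‖phaseAmplitude M θ j‖ ^ 2 := by
        rw [sum_norm_sq_phaseAmplitude M hM]
        gcongr
        exact sum_chord_sq_mul_phaseAmplitude_le M hM θ
    _ = ∑ j, ‖phaseAmplitude M θ j‖ ^ 2 *
        (1 - ρ ^ 2 / 2 * (2 * (1 - Real.cos (θ - estimate M j)))) := by
        rw [Finset.mul_sum, ← Finset.sum_sub_distrib]
        refine Finset.sum_congr rfl fun j _ => ?_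
        ring
    _ ≤ _ := by
        gcongr with j
        refine le_trans ?_ (Real.one_sub_sq_div_two_le_cos)
        have h1 := mul_le_mul_of_nonneg_left (sin_sub_sin_sq_le θ (estimate M j))
          (by positivity : 0 ≤ ρ ^ 2 / 2)
        rw [mul_pow]
        linarith

theorem phaseEstimation_fidelity_ge {κ : Type} [Fintype κ] [DecidableEq κ] {M : ℕ} (hM : 1 ≤ M)
    {U : Matrix κ κ ℂ} (hU : U ∈ Matrix.unitaryGroup κ ℂ) {τ : κ → ℝ} {B : ℝ}
    (hτ : Commute (Matrix.diagonal fun p => (τ p : ℂ)) U) (hB : ∀ p, |τ p| ≤ B)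
    {w : κ → ℂ} (hw : ∑ k, ‖w k‖ ^ 2 = 1) :
    1 - 93 * B ^ 2 / (M : ℝ) ^ 2 ≤
      (star ((phaseEstimation M U).mulVec ((NormedSpace.exp
          ((-Complex.I) • (Matrix.diagonal (fun p => (τ p : ℂ)) * phaseSine U))).mulVec w)) ⬝ᵥ
        (phaseGate M τ).mulVec ((phaseEstimation M U).mulVec w)).re := by
  obtain ⟨I, _, _, v, θ, ρ, hsum, horth, hUv, hρ, hτρ⟩ := exists_joint_eigenvectors hU hτ w
  set c : I → ℂ := fun i => -(Complex.I * ((ρ i * Real.sin (θ i) : ℝ) : ℂ)) with hc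
  have hexp : (NormedSpace.exp
      ((-Complex.I) • (Matrix.diagonal (fun p => (τ p : ℂ)) * phaseSine U))).mulVec w =
      ∑ i, Complex.exp (c i) • v i := by
    -- With the eigenvectors as columns, `W` intertwines the generator with a diagonal matrix, so
    -- its exponential can be read off even though `W` need not be square.
    let W : Matrix κ I ℂ := Matrix.of fun p i => v i p
    have hW : ((-Complex.I) • (Matrix.diagonal (fun p => (τ p : ℂ)) * phaseSine U)) * W =
        W * Matrix.diagonal c := by
      ext p i
      have h1 : (((-Complex.I) • (Matrix.diagonal (fun p => (τ p : ℂ)) * phaseSine U)) * W) p i =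
          ((-Complex.I) • (Matrix.diagonal (fun p => (τ p : ℂ)) * phaseSine U)).mulVec (v i) p := rfl
      rw [h1, Matrix.smul_mulVec, ← Matrix.mulVec_mulVec, phaseSine_mulVec_of_eigenvector hU (hUv i),
        Pi.smul_apply, Matrix.mulVec_diagonal, Matrix.mul_diagonal]
      simp only [Pi.smul_apply, smul_eq_mul, W, Matrix.of_apply, hc]
      by_cases hp : v i p = 0
      · simp [hp]
      · rw [hρ i p hp]
        push_cast
        ring
    have hwW : w = W.mulVec 1 := by
      rw [← hsum]
      ext p
      simp [W, Matrix.mulVec, dotProduct]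
    rw [hwW, Matrix.mulVec_mulVec, exp_mul_eq_mul_exp hW, Matrix.exp_diagonal]
    ext p
    rw [Matrix.mulVec, dotProduct, Finset.sum_apply]
    refine Finset.sum_congr rfl fun i _ => ?_
    rw [Matrix.mul_diagonal, Pi.coe_exp, ← Complex.exp_eq_exp_ℂ]
    simp [W, mul_comm]
  have hinner : star ((phaseEstimation M U).mulVec ((NormedSpace.exp
          ((-Complex.I) • (Matrix.diagonal (fun p => (τ p : ℂ)) * phaseSine U))).mulVec w)) ⬝ᵥ
        (phaseGate M τ).mulVec ((phaseEstimation M U).mulVec w) =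
      ∑ i, ((∑ p, ‖v i p‖ ^ 2 : ℝ) : ℂ) *
        (Complex.exp (Complex.I * ((ρ i * Real.sin (θ i) : ℝ) : ℂ)) *
        ∑ j, star (phaseAmplitude M (θ i) j) * phaseAmplitude M (θ i) j *
          Complex.exp (-(Complex.I * ((ρ i * Real.sin (estimate M j) : ℝ) : ℂ)))) := by
    rw [hexp, ← hsum, Matrix.mulVec_sum, Matrix.mulVec_sum, Matrix.mulVec_sum, star_sum,
      sum_dotProduct]
    refine Finset.sum_congr rfl fun i _ => ?_
    rw [dotProduct_sum, Finset.sum_eq_single i]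
    · rw [Matrix.mulVec_smul, star_smul, smul_dotProduct,
        phaseGate_phaseEstimation_dotProduct M (hUv i) (hUv i) (hρ i), star_dotProduct_self,
        RCLike.star_def, ← Complex.exp_conj, hc, smul_eq_mul]
      simp only [map_neg, map_mul, Complex.conj_I, Complex.conj_ofReal, neg_mul, neg_neg]
      ring
    · intro k _ hk
      rw [Matrix.mulVec_smul, star_smul, smul_dotProduct,
        phaseGate_phaseEstimation_dotProduct M (hUv i) (hUv k) (hρ k), horth i k hk.symm]
      simp
    · simp
  have hnorm : ∑ i, ∑ p, ‖v i p‖ ^ 2 = 1 := by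
    have h1 := star_dotProduct_self w
    rw [hw, ← hsum, star_sum, sum_dotProduct] at h1
    have h2 : ∀ i, star (v i) ⬝ᵥ ∑ k, v k = ((∑ p, ‖v i p‖ ^ 2 : ℝ) : ℂ) := by
      intro i
      rw [dotProduct_sum, Finset.sum_eq_single i (fun k _ hk => horth i k hk.symm) (by simp),
        star_dotProduct_self]
    rw [Finset.sum_congr rfl fun i _ => h2 i] at h1
    exact_mod_cast h1
  have hM0 : (0 : ℝ) < M := by exact_mod_cast hM
  have hpi2 : Real.pi ^ 2 ≤ 10 := by nlinarith [Real.pi_pos, Real.pi_lt_d2]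
  rw [hinner, Complex.re_sum]
  simp only [Complex.re_ofReal_mul]
  calc 1 - 93 * B ^ 2 / (M : ℝ) ^ 2 = ∑ i, (∑ p, ‖v i p‖ ^ 2) * (1 - 93 * B ^ 2 / (M : ℝ) ^ 2) := by
        rw [← Finset.sum_mul, hnorm, one_mul]
    _ ≤ _ := by
        gcongr with i
        refine le_trans ?_ (re_sum_phase_ge M hM (θ i) (ρ i))
        obtain ⟨p, hp⟩ := hτρ i
        have hρB : ρ i ^ 2 ≤ B ^ 2 := by
          rw [← hp]
          exact sq_le_sq' (abs_le.1 (hB p)).1 (abs_le.1 (hB p)).2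
        -- What remains is $2\pi^2\rho_i^2\le93B^2$, with $2\pi^2\le20$, and $M\le M+1$.
        gcongr
        · linarith
        · linarith

theorem diagonal_pairRate_mul_walkIsometry {ι : Type} [Fintype ι] [DecidableEq ι]
    {T : Matrix (ι × ι) ι ℂ} {r : ι → ℝ} (hT : ∀ p j, T p j ≠ 0 → p.1 = j ∧ r p.2 = r j) (t : ℝ) :
    Matrix.diagonal (fun p => ((pairRate r p * t : ℝ) : ℂ)) * T =
      T * Matrix.diagonal (fun j => ((r j * t : ℝ) : ℂ)) := by
  ext p j
  rw [Matrix.diagonal_mul, Matrix.mul_diagonal]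
  by_cases hp : T p j = 0
  · simp [hp]
  · obtain ⟨h1, h2⟩ := hT p j hp
    simp [pairRate, h1, h2, mul_comm]

theorem walkIsometry_mul_evolution {ι : Type} [Fintype ι] [DecidableEq ι]
    {K : Matrix ι ι ℂ} {r d : ι → ℝ} {s : ι → ι → ℂ} (hd : IsPrincipal K r d)
    (hs : IsRootChoice K s) (hr0 : ∀ j, 0 ≤ r j) (hr : ∀ j k, K j k ≠ 0 → r j = r k) (t : ℝ) :
    walkIsometry r d s * evolution K t =
      NormedSpace.exp ((-Complex.I) • (Matrix.diagonal (fun p => ((pairRate r p * t : ℝ) : ℂ)) *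
        phaseSine (walk (walkIsometry r d s)))) * walkIsometry r d s := by
  have hK := diagonal_mul_walkIsometry_swap hd hs hr0 hr
  have hTT := walkIsometry_conjTranspose_mul_self hd hs hr0
  have hT : ∀ p j, walkIsometry r d s p j ≠ 0 → p.1 = j ∧ r p.2 = r j :=
    fun p j h => walkState_ne_zero hs hr h
  set T := walkIsometry r d s
  refine (exp_mul_eq_mul_exp ?_).symm
  have hdiag : Matrix.diagonal (fun j => ((r j * t : ℝ) : ℂ)) =
      (t : ℂ) • Matrix.diagonal (fun j => (r j : ℂ)) := by
    rw [← Matrix.diagonal_smul]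
    congr 1
    ext j
    simp [mul_comm]
  rw [Matrix.smul_mul, Matrix.mul_assoc, phaseSine_walk_mul hTT, ← Matrix.mul_assoc,
    diagonal_pairRate_mul_walkIsometry hT, hdiag, Matrix.mul_assoc, Matrix.smul_mul, hK,
    Matrix.mul_smul, Matrix.mul_smul, smul_smul, neg_mul]

/-- Moving $T^\dagger P^\dagger$ to the other side turns the overlap into $\langle
PTe^{-iKt}\psi,\,FPT\psi\rangle$. The intertwining relation then expresses $Te^{-iKt}\psi$ through
$T\psi$, to which the bound for eigenphases applies. -/
theorem fidelity_simulation_ge {ι : Type} [Fintype ι] [DecidableEq ι]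
    {K : Matrix ι ι ℂ} {r d : ι → ℝ} {s : ι → ι → ℂ} (hd : IsPrincipal K r d)
    (hs : IsRootChoice K s) (hr0 : ∀ j, 0 ≤ r j) (hr : ∀ j k, K j k ≠ 0 → r j = r k) {R : ℝ}
    (hR : 0 ≤ R) (hrR : ∀ j, r j ≤ R) {M : ℕ} (hM : 1 ≤ M) {t : ℝ} (ht : 0 ≤ t) {ψ : ι → ℂ}
    (hψ : ∑ j, ‖ψ j‖ ^ 2 = 1) :
    1 - 93 * (R * t) ^ 2 / (M : ℝ) ^ 2 ≤
      fidelity K t (simulation M r t (walkIsometry r d s)) ψ := by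
  have hTT := walkIsometry_conjTranspose_mul_self hd hs hr0
  have hT : ∀ p j, walkIsometry r d s p j ≠ 0 → p.1 = j ∧ r p.2 = r j :=
    fun p j h => walkState_ne_zero hs hr h
  have hTE := walkIsometry_mul_evolution hd hs hr0 hr t
  set T := walkIsometry r d s
  have hcomm : Commute (Matrix.diagonal fun p => ((pairRate r p * t : ℝ) : ℂ)) (walk T) := by
    refine diagonal_commute_walk (g := fun j => r j * t) (fun p => by rw [pairRate_swap]) ?_
    intro p j hp
    obtain ⟨h1, h2⟩ := hT p j hp
    simp [pairRate, h1, h2]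
  have hB : ∀ p, |pairRate r p * t| ≤ R * t := by
    intro p
    rw [abs_mul, abs_of_nonneg ht]
    gcongr
    unfold pairRate
    split_ifs
    · rw [abs_of_nonneg (hr0 _)]
      exact hrR _
    · simpa using hR
  have hw : ∑ k, ‖T.mulVec ψ k‖ ^ 2 = 1 := by rw [sum_norm_sq_mulVec_of_isometry hTT, hψ]
  have hmain := phaseEstimation_fidelity_ge hM (walk_mem_unitaryGroup hTT) hcomm hB hw
  refine hmain.trans ((Complex.re_le_norm _).trans (le_of_eq ?_))
  rw [fidelity, simulation]
  congr 1
  rw [Matrix.mulVec_mulVec ψ, ← hTE,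
    ← phaseGate_mulVec_phaseEstimation (fun p j h => by rw [(hT p j h).1, (hT p j h).2])]
  simp only [Matrix.mul_assoc, ← Matrix.mulVec_mulVec]
  rw [Matrix.star_mulVec, Matrix.star_mulVec, ← Matrix.dotProduct_mulVec,
    ← Matrix.dotProduct_mulVec]

theorem fidelity_shifted {ι : Type} [Fintype ι] [DecidableEq ι] (H : Matrix ι ι ℂ) (t : ℝ)
    (V : Matrix ι ι ℂ) (ψ : ι → ℂ) : fidelity (shifted H) t V ψ = fidelity H t V ψ := by
  have h : evolution (shifted H) t =
      Complex.exp (-(Complex.I * ((t * energyShift H : ℝ) : ℂ))) • evolution H t := by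
    have h1 : (-(Complex.I * (t : ℂ))) • shifted H = (-(Complex.I * (t : ℂ))) • H +
        Matrix.diagonal (fun _ => -(Complex.I * ((t * energyShift H : ℝ) : ℂ))) := by
      rw [shifted, smul_add, smul_smul, Matrix.smul_one_eq_diagonal]
      congr 2
      funext _
      push_cast
      ring
    have h2 : Matrix.diagonal (fun _ : ι => -(Complex.I * ((t * energyShift H : ℝ) : ℂ))) =
        (-(Complex.I * ((t * energyShift H : ℝ) : ℂ))) • (1 : Matrix ι ι ℂ) :=
      (Matrix.smul_one_eq_diagonal _).symm
    rw [evolution, h1, Matrix.exp_add_of_commute, Matrix.exp_diagonal, Pi.exp_def,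
      ← Complex.exp_eq_exp_ℂ, ← Matrix.smul_one_eq_diagonal, mul_smul_comm, mul_one, evolution]
    rw [h2]
    exact (Commute.one_right _).smul_right _
  rw [fidelity, fidelity, h, Matrix.smul_mulVec, star_smul, smul_dotProduct, norm_smul, norm_star,
    ← mul_neg, ← Complex.ofReal_neg, norm_exp_I_mul_ofReal, one_mul]

/-! ### The circuit of the simulation -/

theorem registerGate_mul {κ ρ L : Type} [Fintype κ] [DecidableEq κ] [Fintype ρ] (l : κ → L)
    (R R' : L → Matrix ρ ρ ℂ) :
    registerGate l R * registerGate l R' = registerGate l fun c => R c * R' c := by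
  ext p q
  simp only [Matrix.mul_apply, registerGate, Matrix.of_apply, Fintype.sum_prod_type, ite_mul,
    zero_mul, mul_ite, mul_zero]
  by_cases h : p.1 = q.1
  · simp [h]
  · rw [if_neg h]
    refine Finset.sum_eq_zero fun k _ => Finset.sum_eq_zero fun x _ => ?_
    split_ifs with h1 h2
    · exact absurd (h2.trans h1) h
    · rfl
    · rfl

theorem registerGate_conjTranspose {κ ρ L : Type} [DecidableEq κ] (l : κ → L)
    (R : L → Matrix ρ ρ ℂ) :
    (registerGate l R).conjTranspose = registerGate l fun c => (R c).conjTranspose := by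
  ext p q
  by_cases h : p.1 = q.1
  · simp [registerGate, h]
  · simp [registerGate, h, Ne.symm h]

theorem WalkCircuit.conjTranspose {κ ρ L : Type} [Fintype κ] [DecidableEq κ] [Fintype ρ]
    [DecidableEq ρ] {l : κ → L} {U : Matrix κ κ ℂ} {n : ℕ} {A : Matrix (κ × ρ) (κ × ρ) ℂ}
    (h : WalkCircuit l U n A) : WalkCircuit l U n A.conjTranspose := by
  induction h with
  | register R hR =>
    rw [registerGate_conjTranspose]
    exact .register _ fun c => Unitary.star_mem (hR c)
  | step b => exact .stepInv b
  | stepInv b =>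
    rw [Matrix.conjTranspose_conjTranspose]
    exact .step b
  | comp _ _ ih1 ih2 =>
    rw [Matrix.conjTranspose_mul, add_comm]
    exact .comp ih2 ih1

/-- Step number $i$, counted from $0$, is active for the register values $x$ with $i<f(x)$, so $x$
receives $\min(f(x),n)$ applications. -/
theorem walkCircuit_blockDiagonal_pow {κ ρ L : Type} [Fintype κ] [DecidableEq κ] [Fintype ρ]
    [DecidableEq ρ] (l : κ → L) (U : Matrix κ κ ℂ) (f : ρ → ℕ) (n : ℕ) :
    WalkCircuit l U n (Matrix.blockDiagonal fun x => U ^ min (f x) n) := by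
  induction n with
  | zero =>
    have h : Matrix.blockDiagonal (fun x : ρ => U ^ min (f x) 0) =
        registerGate l fun _ => (1 : Matrix ρ ρ ℂ) := by
      ext p q
      simp only [Nat.min_zero, pow_zero, Matrix.blockDiagonal_apply, registerGate, Matrix.of_apply,
        Matrix.one_apply]
      split_ifs <;> rfl
    rw [h]
    exact .register _ fun _ => one_mem _
  | succ n ih =>
    have h : Matrix.blockDiagonal (fun x : ρ => U ^ min (f x) (n + 1)) =
        controlledStep U (fun x => decide (n < f x)) *
          Matrix.blockDiagonal fun x => U ^ min (f x) n := by
      have h1 : controlledStep U (fun x => decide (n < f x)) =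
          Matrix.blockDiagonal fun x => if n < f x then U else 1 := by
        ext p q
        simp only [controlledStep, Matrix.of_apply, Matrix.blockDiagonal_apply, decide_eq_true_eq]
        split_ifs <;> rfl
      rw [h1, ← Matrix.blockDiagonal_mul]
      congr 1
      ext1 x
      split_ifs with hx
      · rw [min_eq_right (by omega), min_eq_right hx.le, pow_succ']
      · rw [min_eq_left (by omega), min_eq_left (by omega), one_mul]
    rw [h, add_comm]
    exact .comp (.step _) ih

theorem walkCircuit_selectPower {κ L : Type} [Fintype κ] [DecidableEq κ] (l : κ → L) (M : ℕ)
    (U : Matrix κ κ ℂ) : WalkCircuit l U (M - 1) (selectPower M U) := by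
  have h : selectPower M U =
      Matrix.blockDiagonal fun x : Fin M => U ^ min (x : ℕ) (M - 1) := by
    ext p q
    rw [selectPower, Matrix.of_apply, Matrix.blockDiagonal_apply, min_eq_left (by omega)]
  rw [h]
  exact walkCircuit_blockDiagonal_pow l U _ _

/-- $P$ and $P^\dagger$ cost $M-1$ steps each. Both Fourier transforms and $F$ merge into one
register gate, which sees the system only through the label. -/
theorem usesWalkSteps_simulation {ι L : Type} [Fintype ι] [DecidableEq ι] {M : ℕ} (hM : 1 ≤ M)
    (l : ι × ι → L) {r : ι → ℝ} {ω : L → ℝ} (hω : ∀ p, r p.1 = ω (l p)) (t : ℝ)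
    (T : Matrix (ι × ι) ι ℂ) :
    UsesWalkSteps l (walk T) T (2 * (M - 1)) (simulation M r t T) := by
  let G : L → Matrix (Fin M) (Fin M) ℂ := fun c => Matrix.diagonal fun j =>
    Complex.exp (-(Complex.I * ((ω c * t * Real.sin (estimate M j) : ℝ) : ℂ)))
  have hG : ∀ c, G c ∈ Matrix.unitaryGroup (Fin M) ℂ := by
    intro c
    rw [Matrix.mem_unitaryGroup_iff', Matrix.star_eq_conjTranspose, Matrix.diagonal_conjTranspose,
      Matrix.diagonal_mul_diagonal, ← Matrix.diagonal_one]
    congr 1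
    ext j
    rw [Pi.star_apply, RCLike.star_def, Complex.conj_mul', ← mul_neg, ← Complex.ofReal_neg,
      norm_exp_I_mul_ofReal]
    simp
  have hF : phaseGate M (fun p : ι × ι => r p.1 * t) = registerGate l G := by
    ext p q
    simp only [phaseGate, registerGate, G, Matrix.diagonal_apply, Matrix.of_apply, hω, Prod.ext_iff]
    by_cases h1 : p.1 = q.1 <;> by_cases h2 : p.2 = q.2 <;> simp [h1, h2]
  have hQ : (Matrix.kroneckerMap (· * ·) (1 : Matrix (ι × ι) (ι × ι) ℂ) (invFourier M)) =
      registerGate l fun _ => invFourier M := by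
    ext p q
    simp [registerGate, Matrix.one_apply]
  have hQu := invFourier_mem_unitaryGroup M
  refine ⟨M, sineWindow M, (selectPower M (walk T)).conjTranspose *
    registerGate l (fun c => (invFourier M).conjTranspose * (G c * invFourier M)) *
      selectPower M (walk T), sum_norm_sq_sineWindow M hM, ?_, ?_⟩
  · have h := WalkCircuit.comp (WalkCircuit.comp (walkCircuit_selectPower l M (walk T)).conjTranspose
      (WalkCircuit.register (fun c => (invFourier M).conjTranspose * (G c * invFourier M))
        fun c => mul_mem (Unitary.star_mem hQu) (mul_mem (hG c) hQu)))
      (walkCircuit_selectPower l M (walk T))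
    rwa [add_zero, ← two_mul] at h
  · rw [simulation, phaseEstimation, hF, hQ, ← registerGate_mul, ← registerGate_mul,
      ← registerGate_conjTranspose]
    simp only [Matrix.conjTranspose_mul, Matrix.mul_assoc]

/-- With $M=\lfloor20a/\sqrt\delta\rfloor+1$ the loss is at most $93\cdot4/400\cdot\delta<\delta$.
The factor $2$ in $2a$ provides for the doubling of the norm by the shift. -/
theorem exists_register_size {a δ : ℝ} (ha : 0 ≤ a) (hδ : 0 < δ) :
    ∃ M : ℕ, 1 ≤ M ∧ ((2 * (M - 1) : ℕ) : ℝ) ≤ 40 * (a / Real.sqrt δ) ∧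
      93 * (2 * a) ^ 2 / (M : ℝ) ^ 2 ≤ δ := by
  have hs : 0 < Real.sqrt δ := Real.sqrt_pos.2 hδ
  set x := 20 * (a / Real.sqrt δ) with hx
  have hx0 : 0 ≤ x := by positivity
  refine ⟨⌊x⌋₊ + 1, by omega, ?_, ?_⟩
  · rw [Nat.add_sub_cancel]
    push_cast
    linarith [Nat.floor_le hx0]
  · have h1 : x ≤ (⌊x⌋₊ + 1 : ℕ) := by
      push_cast
      exact (Nat.lt_floor_add_one x).le
    have h2 : 2 * a = x * Real.sqrt δ / 10 := by
      rw [hx]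
      field_simp
      ring
    have h3 : (0 : ℝ) < (⌊x⌋₊ + 1 : ℕ) := by positivity
    rw [div_le_iff₀ (by positivity), h2, div_pow, mul_pow, Real.sq_sqrt hδ.le]
    have h4 : x ^ 2 ≤ ((⌊x⌋₊ + 1 : ℕ) : ℝ) ^ 2 := by gcongr
    nlinarith [mul_le_mul_of_nonneg_right h4 hδ.le, mul_nonneg (sq_nonneg x) hδ.le]

end

end QWalk

/-! ### Assembly of the four claims -/

theorem theorem5 :
    -- (1) mean-square error of phase estimation with the sine window
    (∀ (n M : ℕ), 1 ≤ M → ∀ (U : Matrix (Fin n) (Fin n) ℂ), U ∈ Matrix.unitaryGroup (Fin n) ℂ →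
      ∀ (v : Fin n → ℂ) (θ : ℝ), ∑ k, ‖v k‖ ^ 2 = 1 →
        U.mulVec v = Complex.exp (Complex.I * (θ : ℂ)) • v →
        ∑ j, phaseError M θ j ^ 2 * outcomeProb M U v j ≤ 186 / (M : ℝ) ^ 2) ∧
    -- (2) irreducible Hamiltonians with nonnegative diagonal entries: the walk of `H` itself
    (∀ (N : ℕ) (H : Matrix (Fin N) (Fin N) ℂ), H.IsHermitian → (hamGraph H).Connected →
      (∀ j, 0 ≤ (H j j).re) →
      (∃ d, IsPrincipal H (fun _ => opNorm (absMatrix H)) d) ∧ (∃ s, IsRootChoice H s) ∧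
      ∀ d s, IsPrincipal H (fun _ => opNorm (absMatrix H)) d → IsRootChoice H s →
        ∀ T, T = walkIsometry (fun _ => opNorm (absMatrix H)) d s →
        walk T ∈ Matrix.unitaryGroup (Fin N × Fin N) ℂ ∧
        ∀ (M : ℕ) (t : ℝ), 1 ≤ M → 0 ≤ t →
          UsesWalkSteps (fun _ => ()) (walk T) T (2 * (M - 1))
            (simulation M (fun _ => opNorm (absMatrix H)) t T) ∧
          ∀ ψ : Fin N → ℂ, ∑ j, ‖ψ j‖ ^ 2 = 1 →
            1 - 93 * (opNorm (absMatrix H) * t) ^ 2 / (M : ℝ) ^ 2 ≤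
              fidelity H t (simulation M (fun _ => opNorm (absMatrix H)) t T) ψ) ∧
    ∃ C : ℝ, 0 < C ∧
      -- (3) the number of steps for irreducible Hamiltonians with nonnegative diagonal entries
      (∀ (N : ℕ) (H : Matrix (Fin N) (Fin N) ℂ), H.IsHermitian → (hamGraph H).Connected →
        (∀ j, 0 ≤ (H j j).re) → ∀ (t δ : ℝ), 0 ≤ t → 0 < δ →
        ∃ M : ℕ, 1 ≤ M ∧
          ((2 * (M - 1) : ℕ) : ℝ) ≤ C * (opNorm (absMatrix H) * t / Real.sqrt δ) ∧
          ∀ d s, IsPrincipal H (fun _ => opNorm (absMatrix H)) d → IsRootChoice H s →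
            ∀ T, T = walkIsometry (fun _ => opNorm (absMatrix H)) d s →
            UsesWalkSteps (fun _ => ()) (walk T) T (2 * (M - 1))
              (simulation M (fun _ => opNorm (absMatrix H)) t T) ∧
            ∀ ψ : Fin N → ℂ, ∑ j, ‖ψ j‖ ^ 2 = 1 →
              1 - δ ≤ fidelity H t (simulation M (fun _ => opNorm (absMatrix H)) t T) ψ) ∧
      -- (4) arbitrary Hamiltonians: the walk of `H + c` with the components side by side
      (∀ (N : ℕ) (H : Matrix (Fin N) (Fin N) ℂ), H.IsHermitian →
        (∃ d, IsPrincipal (shifted H) (componentNorm (shifted H)) d) ∧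
        (∃ s, IsRootChoice (shifted H) s) ∧
        ∀ (t δ : ℝ), 0 ≤ t → 0 < δ →
        ∃ M : ℕ, 1 ≤ M ∧
          ((2 * (M - 1) : ℕ) : ℝ) ≤ C * (opNorm (absMatrix H) * t / Real.sqrt δ) ∧
          ∀ d s, IsPrincipal (shifted H) (componentNorm (shifted H)) d →
            IsRootChoice (shifted H) s →
            ∀ T, T = walkIsometry (componentNorm (shifted H)) d s →
            walk T ∈ Matrix.unitaryGroup (Fin N × Fin N) ℂ ∧
            UsesWalkSteps (fun p => (hamGraph H).connectedComponentMk p.1) (walk T) T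
              (2 * (M - 1)) (simulation M (componentNorm (shifted H)) t T) ∧
            ∀ ψ : Fin N → ℂ, ∑ j, ‖ψ j‖ ^ 2 = 1 →
              1 - δ ≤ fidelity H t (simulation M (componentNorm (shifted H)) t T) ψ) := by
  -- The free bound `R` serves twice: the norm itself gives the sharp estimate in (2), and twice the
  -- norm fits `exists_register_size` in (3).
  have hconn : ∀ (N : ℕ) (H : Matrix (Fin N) (Fin N) ℂ) (R : ℝ), opNorm (absMatrix H) ≤ R →
      ∀ d s, IsPrincipal H (fun _ => opNorm (absMatrix H)) d → IsRootChoice H s →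
      ∀ (M : ℕ) (t : ℝ), 1 ≤ M → 0 ≤ t →
      UsesWalkSteps (fun _ => ()) (walk (walkIsometry (fun _ => opNorm (absMatrix H)) d s))
        (walkIsometry (fun _ => opNorm (absMatrix H)) d s) (2 * (M - 1))
        (simulation M (fun _ => opNorm (absMatrix H)) t
          (walkIsometry (fun _ => opNorm (absMatrix H)) d s)) ∧
      ∀ ψ : Fin N → ℂ, ∑ j, ‖ψ j‖ ^ 2 = 1 → 1 - 93 * (R * t) ^ 2 / (M : ℝ) ^ 2 ≤
        fidelity H t (simulation M (fun _ => opNorm (absMatrix H)) t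
          (walkIsometry (fun _ => opNorm (absMatrix H)) d s)) ψ := by
    intro N H R hR d s hd hs M t hM ht
    refine ⟨usesWalkSteps_simulation hM _ (ω := fun _ => opNorm (absMatrix H)) (fun _ => rfl) t _,
      fun ψ hψ => ?_⟩
    exact fidelity_simulation_ge hd hs (fun _ => opNorm_nonneg _) (fun _ _ _ => rfl)
      ((opNorm_nonneg _).trans hR) (fun _ => hR) hM ht hψ
  refine ⟨fun n M hM U _ v θ hv h => mean_square_phaseError_le M hM hv h, ?_, 40, by norm_num,
    ?_, ?_⟩
  · intro N H hH hc hdiag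
    refine ⟨?_, exists_isRootChoice hH hdiag, ?_⟩
    · obtain ⟨d, hd⟩ := exists_isPrincipal_componentNorm hH
      exact ⟨d, hd.1, fun j => by rw [hd.2, componentNorm_eq_opNorm_of_connected hc]⟩
    · rintro d s hd hs T rfl
      exact ⟨walk_mem_unitaryGroup
          (walkIsometry_conjTranspose_mul_self hd hs fun _ => opNorm_nonneg _),
        fun M t hM ht => hconn N H _ le_rfl d s hd hs M t hM ht⟩
  · intro N H _ _ _ t δ ht hδ
    have h0 := opNorm_nonneg (absMatrix H)
    obtain ⟨M, hM, hsteps, hfid⟩ := exists_register_size (mul_nonneg h0 ht) hδ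
    refine ⟨M, hM, hsteps, ?_⟩
    rintro d s hd hs T rfl
    obtain ⟨h1, h2⟩ := hconn N H (2 * opNorm (absMatrix H)) (by linarith) d s hd hs M t hM ht
    refine ⟨h1, fun ψ hψ => le_trans ?_ (h2 ψ hψ)⟩
    rw [mul_assoc 2]
    linarith
  · intro N H hH
    have hK := isHermitian_shifted hH
    refine ⟨exists_isPrincipal_componentNorm hK, exists_isRootChoice hK (shifted_diag_re_nonneg H),
      fun t δ ht hδ => ?_⟩
    have h0 := opNorm_nonneg (absMatrix H)
    obtain ⟨M, hM, hsteps, hfid⟩ := exists_register_size (mul_nonneg h0 ht) hδ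
    refine ⟨M, hM, hsteps, ?_⟩
    rintro d s hd hs T rfl
    refine ⟨walk_mem_unitaryGroup
      (walkIsometry_conjTranspose_mul_self hd hs (componentNorm_nonneg _)), ?_, fun ψ hψ => ?_⟩
    -- The rate is constant on a component, so it can be read off at a representative; the shift
    -- leaves the graph unchanged.
    · refine usesWalkSteps_simulation hM _ (ω := fun c => componentNorm (shifted H) c.out) ?_ t _
      intro p
      refine (componentNorm_eq_of_reachable ?_).symm
      rw [hamGraph_shifted]
      exact SimpleGraph.ConnectedComponent.exact (Quot.out_eq _)
    · rw [← fidelity_shifted]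
      refine le_trans ?_ (fidelity_simulation_ge hd hs (componentNorm_nonneg _)
        (fun j k h => componentNorm_eq_of_reachable (reachable_of_apply_ne_zero h))
        (R := 2 * opNorm (absMatrix H)) (by linarith)
        (fun j => (componentNorm_le _ j).trans (opNorm_absMatrix_shifted_le H)) hM ht hψ)
      rw [mul_assoc 2]
      linarith
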